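/- Let $k$ be an algebraically closed field of characteristic $2$, let $G$ be the simple algebraic group of type $\mathrm{G}_2$ over $k$, realised as the automorphism group of the split octonion algebra over $k$, and let $\mathfrak g=\mathrm{Lie}(G)$. Then $\mathfrak g\cong\mathfrak{psl}_4=\mathfrak{sl}_4(k)/k1$. Let $O=O(2;\underline 1)=k[X,Y]/(X^2,Y^2)$, let $W(2;\underline 1)=\mathrm{Der}_k(O)$ act on $O$ in the natural way, and form the semidirect product $\hat{\mathcal W}=W(2;\underline 1)\ltimes O$, in which $O$ is an abelian ideal. Let $V$ be the $4$-dimensional vector space $O$, put $\mathfrak{psl}(V)=\mathfrak{sl}(V)/k\,\mathrm{Id}_V$ (so that $\mathfrak{psl}(V)\cong\mathfrak g$), and let $\rho\colon\hat{\mathcal W}\to\mathfrak{gl}(V)$ be the representation $\rho(D,f)(v)=D(v)+fv$. Then $\rho(\hat{\mathcal W})\subseteq\mathfrak{sl}(V)$, the Lie algebra $\mathcal W=\hat{\mathcal W}/k1$ has dimension $11$, and $\rho$ induces an injective homomorphism of Lie algebras $j\colon\mathcal W\to\mathfrak{psl}(V)$. For every isomorphism of Lie algebras $\varphi\colon\mathfrak{psl}(V)\to\mathfrak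 g$, the subalgebra $M=\varphi(j(\mathcal W))$ is a maximal Lie subalgebra of $\mathfrak g$, its radical is nonzero, and $M$ is not parabolic: there is no parabolic subgroup $P$ of $G$ with $M=\mathrm{Lie}(P)$. -/

import Mathlib

attribute [local instance 100] LieRing.ofAssociativeRing

/-! ### Linear algebraic groups and their Lie algebras

Polynomial functions on `End V` are written as polynomials in variables indexed by the linear forms
on `End V`; the variable `φ` takes the value `φ a` at `a`. The group `GL(V)` is `V ≃ₗ[k] V`. -/

namespace LinAlgGroup

variable {k V : Type*} [Field k] [AddCommGroup V] [Module k V]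

/-- The value of a polynomial function on `End V` at the endomorphism `a`. -/
noncomputable def evalAt (a : Module.End k V) :
    MvPolynomial (Module.Dual k (Module.End k V)) k →ₐ[k] k :=
  MvPolynomial.aeval (fun φ => φ a)

/-- The derivation of the ring of polynomial functions which differentiates in the constant
direction `x`: it sends the linear form `φ` to the constant `φ x`. -/
noncomputable def dirDeriv (x : Module.End k V) :
    Derivation k (MvPolynomial (Module.Dual k (Module.End k V)) k)
      (MvPolynomial (Module.Dual k (Module.End k V)) k) :=
  MvPolynomial.mkDerivation k (fun φ => MvPolynomial.C (φ x))

/-- The polynomial function `f` vanishes on the subgroup `G` of `GL(V)`. -/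
def VanishesOn (f : MvPolynomial (Module.Dual k (Module.End k V)) k)
    (G : Subgroup (V ≃ₗ[k] V)) : Prop :=
  ∀ g ∈ G, evalAt (g : Module.End k V) f = 0

/-- The Zariski topology on `GL(V)`, with the principal open sets as a base. -/
abbrev zariski (k V : Type*) [Field k] [AddCommGroup V] [Module k V] :
    TopologicalSpace (V ≃ₗ[k] V) :=
  TopologicalSpace.generateFrom
    {U | ∃ f : MvPolynomial (Module.Dual k (Module.End k V)) k,
      U = {g : V ≃ₗ[k] V | evalAt (g : Module.End k V) f ≠ 0}}

/-- The derivation of the ring of polynomial functions which sends the linear form `φ` to the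
linear form `a ↦ φ (a x)`; it is invariant under left translations. -/
noncomputable def leftInvDeriv (x : Module.End k V) :
    Derivation k (MvPolynomial (Module.Dual k (Module.End k V)) k)
      (MvPolynomial (Module.Dual k (Module.End k V)) k) :=
  MvPolynomial.mkDerivation k (fun φ => MvPolynomial.X (φ ∘ₗ LinearMap.mulRight k x))

theorem evalAt_leftInvDeriv (g x : Module.End k V)
    (f : MvPolynomial (Module.Dual k (Module.End k V)) k) :
    evalAt g (leftInvDeriv x f) =
      evalAt 1 (dirDeriv x (MvPolynomial.rename (fun φ => φ ∘ₗ LinearMap.mulLeft k g) f)) := by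
  have h1 : ∀ f : MvPolynomial (Module.Dual k (Module.End k V)) k,
      evalAt 1 (MvPolynomial.rename (fun φ => φ ∘ₗ LinearMap.mulLeft k g) f) = evalAt g f := by
    intro f
    simp [evalAt, MvPolynomial.aeval_rename, Function.comp_def]
  induction f using MvPolynomial.induction_on with
  | C a => simp [leftInvDeriv, dirDeriv]
  | add p q hp hq => simp [hp, hq]
  | mul_X p φ hp =>
    rw [Derivation.leibniz, map_mul, Derivation.leibniz]
    simp only [smul_eq_mul, map_add, map_mul, h1, hp]
    simp [leftInvDeriv, dirDeriv, evalAt]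

theorem evalAt_one_leftInvDeriv (x : Module.End k V)
    (f : MvPolynomial (Module.Dual k (Module.End k V)) k) :
    evalAt 1 (leftInvDeriv x f) = evalAt 1 (dirDeriv x f) := by
  rw [evalAt_leftInvDeriv]
  have : (fun φ : Module.Dual k (Module.End k V) => φ ∘ₗ LinearMap.mulLeft k 1) = id := by
    funext φ; ext a; simp
  rw [this, MvPolynomial.rename_id_apply]

theorem evalAt_dirDeriv_lie (x y : Module.End k V)
    (f : MvPolynomial (Module.Dual k (Module.End k V)) k) :
    evalAt 1 (dirDeriv ⁅x, y⁆ f) =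
      evalAt 1 (leftInvDeriv x (leftInvDeriv y f)) -
        evalAt 1 (leftInvDeriv y (leftInvDeriv x f)) := by
  induction f using MvPolynomial.induction_on with
  | C a => simp [leftInvDeriv, dirDeriv]
  | add p q hp hq => simp only [map_add, hp, hq]; ring
  | mul_X p φ hp =>
    have e : evalAt 1 (dirDeriv ⁅x, y⁆ (MvPolynomial.X φ)) =
      evalAt 1 (leftInvDeriv x (leftInvDeriv y (MvPolynomial.X φ))) -
        evalAt 1 (leftInvDeriv y (leftInvDeriv x (MvPolynomial.X φ))) := by
      simp [leftInvDeriv, dirDeriv, evalAt, Ring.lie_def]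
    simp only [Derivation.leibniz, smul_eq_mul, map_add, map_mul, hp, e]
    ring

theorem VanishesOn.leftInvDeriv {G : Subgroup (V ≃ₗ[k] V)} {x : Module.End k V}
    (hx : ∀ f, VanishesOn f G → evalAt 1 (dirDeriv x f) = 0)
    {f : MvPolynomial (Module.Dual k (Module.End k V)) k} (hf : VanishesOn f G) :
    VanishesOn (leftInvDeriv x f) G := by
  intro g hg
  rw [evalAt_leftInvDeriv]
  refine hx _ fun h hh => ?_
  have := hf (g * h) (G.mul_mem hg hh)
  rw [← this]
  simp only [evalAt, MvPolynomial.aeval_rename]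
  rfl

/-- The Lie algebra of a subgroup `G` of `GL(V)`: the tangent space at the identity of (the Zariski
closure of) `G`, that is the set of all `x ∈ End V` such that `(df)₁(x) = 0` for every polynomial
function `f` vanishing on `G`, with the commutator as bracket. -/
noncomputable def lieAlg (G : Subgroup (V ≃ₗ[k] V)) : LieSubalgebra k (Module.End k V) where
  carrier := {x | ∀ f, VanishesOn f G → evalAt 1 (dirDeriv x f) = 0}
  zero_mem' := by
    intro f _
    have : dirDeriv (0 : Module.End k V) = 0 := by
      apply MvPolynomial.derivation_ext; intro φ; simp [dirDeriv]
    simp [this]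
  add_mem' := by
    intro x y hx hy f hf
    have : dirDeriv (x + y) = dirDeriv x + dirDeriv y := by
      apply MvPolynomial.derivation_ext; intro φ; simp [dirDeriv]
    simp [this, hx f hf, hy f hf]
  smul_mem' := by
    intro c x hx f hf
    have : dirDeriv (c • x) = c • dirDeriv x := by
      apply MvPolynomial.derivation_ext; intro φ
      simp [dirDeriv, MvPolynomial.smul_eq_C_mul]
    simp [this, hx f hf]
  lie_mem' := by
    intro x y hx hy f hf
    rw [evalAt_dirDeriv_lie, evalAt_one_leftInvDeriv, evalAt_one_leftInvDeriv,
      hx _ (VanishesOn.leftInvDeriv hy hf), hy _ (VanishesOn.leftInvDeriv hx hf), sub_zero]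

/-- `B` is a closed connected solvable subgroup of `G`. -/
structure IsClosedConnectedSolvable (G B : Subgroup (V ≃ₗ[k] V)) : Prop where
  le : B ≤ G
  closed : @IsClosed _ (zariski k V) (B : Set (V ≃ₗ[k] V))
  connected : @IsConnected _ (zariski k V) (B : Set (V ≃ₗ[k] V))
  solvable : Group.IsSolvable B

/-- A Borel subgroup of `G`: a maximal closed connected solvable subgroup. -/
def IsBorel (G B : Subgroup (V ≃ₗ[k] V)) : Prop :=
  Maximal (IsClosedConnectedSolvable G) B

/-- A parabolic subgroup of `G`: a closed subgroup which contains a Borel subgroup of `G`. -/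
structure IsParabolic (G P : Subgroup (V ≃ₗ[k] V)) : Prop where
  le : P ≤ G
  closed : @IsClosed _ (zariski k V) (P : Set (V ≃ₗ[k] V))
  exists_borel : ∃ B, IsBorel G B ∧ B ≤ P

end LinAlgGroup

/-! ### The group of type `G₂` -/

/-- The underlying space of the split octonion (Cayley) algebra over `k`. -/
abbrev SplitOct (k : Type*) : Type _ :=
  Matrix (Fin 2) (Fin 2) k × Matrix (Fin 2) (Fin 2) k

/-- The multiplication of the split octonion algebra, the Cayley-Dickson double of the algebra of
`2 × 2` matrices: `(a, b)(c, d) = (a c + d* b, d a + b c*)`, where `*` is the adjugate. -/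
def SplitOct.mul {k : Type*} [Field k] (x y : SplitOct k) : SplitOct k :=
  (x.1 * y.1 + y.2.adjugate * x.2, y.2 * x.1 + x.2 * y.1.adjugate)

/-- The simple algebraic group of type `G₂` over the algebraically closed field `k`: the
automorphism group of the split octonion algebra, a Zariski closed subgroup of `GL₈(k)`. -/
def groupG2 (k : Type*) [Field k] : Subgroup (SplitOct k ≃ₗ[k] SplitOct k) where
  carrier := {g | ∀ x y, g (SplitOct.mul x y) = SplitOct.mul (g x) (g y)}
  one_mem' := fun _ _ => rfl
  mul_mem' := by
    intro g h hg hh x y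
    simp only [Set.mem_ofPred_eq, LinearEquiv.mul_apply] at *
    rw [hh, hg]
  inv_mem' := by
    intro g hg x y
    have e : ∀ z, g (g⁻¹ z) = z := g.apply_symm_apply
    apply g.injective
    rw [hg, e, e, e]

/-! ### Projective special linear Lie algebras -/

/-- `sl(V)`: the endomorphisms of trace zero. -/
noncomputable def slEnd (k V : Type*) [Field k] [AddCommGroup V] [Module k V] :
    LieSubalgebra k (Module.End k V) where
  __ := LinearMap.ker (LinearMap.trace k V)
  lie_mem' := by
    intro x y _ _
    simp [Ring.lie_def, LinearMap.trace_mul_comm k x y]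

/-- The ideal of all scalar endomorphisms in `sl(V)`. -/
def slEndScalars (k V : Type*) [Field k] [AddCommGroup V] [Module k V] :
    LieIdeal k (slEnd k V) where
  carrier := {x | ∃ c : k, (x : Module.End k V) = c • 1}
  zero_mem' := ⟨0, by simp⟩
  add_mem' := by
    rintro x y ⟨c, hc⟩ ⟨d, hd⟩
    exact ⟨c + d, by simp [hc, hd, add_smul]⟩
  smul_mem' := by
    rintro a x ⟨c, hc⟩
    exact ⟨a * c, by simp [hc, mul_smul]⟩
  lie_mem := by
    rintro x y ⟨c, hc⟩
    exact ⟨0, by simp [hc, Ring.lie_def]⟩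

/-- `psl(V) = sl(V) / k Id`. -/
abbrev pslEnd (k V : Type*) [Field k] [AddCommGroup V] [Module k V] : Type _ :=
  slEnd k V ⧸ slEndScalars k V

/-- The ideal of all scalar matrices in `sl_n(k)`. -/
def slScalars (n : ℕ) (k : Type*) [Field k] :
    LieIdeal k (LieAlgebra.SpecialLinear.sl (Fin n) k) where
  carrier := {x | ∃ c : k, (x : Matrix (Fin n) (Fin n) k) = c • 1}
  zero_mem' := ⟨0, by simp⟩
  add_mem' := by
    rintro x y ⟨c, hc⟩ ⟨d, hd⟩
    exact ⟨c + d, by simp [hc, hd, add_smul]⟩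
  smul_mem' := by
    rintro a x ⟨c, hc⟩
    exact ⟨a * c, by simp [hc, mul_smul]⟩
  lie_mem := by
    rintro x y ⟨c, hc⟩
    exact ⟨0, by simp [hc, Ring.lie_def]⟩

/-- `psl_n = sl_n(k) / k 1`. -/
abbrev psl (n : ℕ) (k : Type*) [Field k] : Type _ :=
  LieAlgebra.SpecialLinear.sl (Fin n) k ⧸ slScalars n k

/-! ### The Witt-Jacobson algebra and its semidirect product with the truncated polynomials -/

section Generic

variable (k A : Type*) [Field k] [CommRing A] [Algebra k A]

/-- The natural action of the derivations of a commutative algebra `A` on `A`, the latter regarded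
as an abelian Lie algebra (with the commutator, which is zero, as bracket). -/
def derAction : Derivation k A A →ₗ⁅k⁆ LieDerivation k A A where
  toFun D := ⟨D, fun a b => by simp [Ring.lie_def, mul_comm]⟩
  map_add' _ _ := rfl
  map_smul' _ _ := rfl
  map_lie' {D E} := by
    ext a
    rw [LieDerivation.commutator_apply]
    exact Derivation.commutator_apply (D1 := D) (D2 := E) a

/-- The semidirect product `Der(A) ⋉ A`, in which `A` is an abelian ideal. -/
abbrev DerSemidirect : Type _ :=
  LieAlgebra.SemiDirectSum A (Derivation k A A) (derAction k A)

/-- The ideal `k 1` of `Der(A) ⋉ A`, where `1` is the identity of `A`. -/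
def scalarIdeal : LieIdeal k (DerSemidirect k A) where
  carrier := {w | w.right = 0 ∧ ∃ c : k, w.left = c • 1}
  zero_mem' := ⟨rfl, 0, by simp⟩
  add_mem' := by
    rintro x y ⟨hx, c, hc⟩ ⟨hy, d, hd⟩
    exact ⟨by simp [hx, hy], c + d, by simp [hc, hd, add_smul]⟩
  smul_mem' := by
    rintro a x ⟨hx, c, hc⟩
    exact ⟨by simp [hx], a * c, by simp [hc, mul_smul]⟩
  lie_mem := by
    rintro x y ⟨hy, c, hc⟩
    have h : ∀ D : Derivation k A A, derAction k A D (1 : A) = 0 := fun D => D.map_one_eq_zero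
    exact ⟨by simp only [LieAlgebra.SemiDirectSum.lie_eq_mk, hy, lie_zero], 0,
      by simp [hy, hc, Ring.lie_def, h]⟩

/-- The representation of `Der(A) ⋉ A` on the vector space `A`: derivations act naturally and
elements of `A` act by multiplication. -/
def derRep : DerSemidirect k A →ₗ⁅k⁆ Module.End k A where
  toFun w := (w.right : A →ₗ[k] A) + LinearMap.mulLeft k w.left
  map_add' x y := by ext a; simp [add_mul]; ring
  map_smul' c x := by ext a; simp
  map_lie' {x y} := by
    have h : ∀ (D : Derivation k A A) (a : A), derAction k A D a = D a := fun _ _ => rfl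
    ext a
    simp [Ring.lie_def, h, mul_comm]
    ring

end Generic

/-- The truncated polynomial ring `O(2;1) = k[X, Y]/(X², Y²)` (for `k` of characteristic `2`). -/
abbrev TruncPoly (k : Type*) [Field k] : Type _ :=
  MvPolynomial (Fin 2) k ⧸
    Ideal.span (Set.range fun i : Fin 2 => (MvPolynomial.X i : MvPolynomial (Fin 2) k) ^ 2)

/-- The semidirect product `W(2;1) ⋉ O(2;1)`, where `W(2;1) = Der(O(2;1))` is the Witt-Jacobson Lie
algebra. -/
abbrev WHat (k : Type*) [Field k] : Type _ := DerSemidirect k (TruncPoly k)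

/-- The Lie algebra `(W(2;1) ⋉ O(2;1)) / k 1`. -/
abbrev WQuot (k : Type*) [Field k] : Type _ := WHat k ⧸ scalarIdeal k (TruncPoly k)

/-! Lie algebra of `groupG2`. In characteristic two a traceless `4 × 4` matrix acts on the octonions
by a derivation (`pslAct`); modulo the unit, the traceless octonions are the exterior square of the
natural module. Every derivation arises in this way, and exactly the scalar matrices act as zero.
The tangent space of the automorphism group lies in the derivations, and it contains all of them,
because the last row and the last column of the matrix give tangent vectors of explicit curves of
involutions, and brackets of these fill the rest. Hence the Lie algebra is `psl₄`.

Maximality. The operators `D + f` on `A = O(2;1)` are those of order at most one, that is the kernel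
of the coefficient `symbol` of `∂x ∂y`. The trace of an operator is the `xy`-coefficient of its
symbol, so the symbols of traceless operators are spanned by `1, x, y`, and the image has
codimension three. A larger subalgebra contains an operator with nonzero symbol; brackets with `∂x,
∂y` lower the symbol to a constant, and brackets with `xy ∂x, xy ∂y` then produce `y` and `x`
(`eq_top_of_symbol_ne_zero`). The radical is nonzero because `A / k1` is an abelian ideal.

Not parabolic. The image is not `Lie(P)` for any subgroup `P` of the automorphism group
(`not_lieAlg`). The algebra `Der(A) ⋉ A` is perfect, hence acts trivially in dimension at most two,
whereas the stabilizer of a traceless octonion modulo scalars has codimension at least four. So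
every stable subspace of traceless octonions properly containing the unit has dimension at least
four (`four_le_finrank`). Since `A` acts by commuting operators of square zero, there is such a
subspace `S` of dimension four that is totally isotropic for the polar form (`exists_isotropic`),
and it is unique (`isStable_unique`). If the image were `Lie(P)`, uniqueness would make `S` stable
under `P`. Automorphisms preserve the norm, and the norm is additive on `S`, so the singular vectors
of `S` form a three-dimensional subspace `U` stable under `P` and hence under `Lie(P)`. This is
impossible: `U · U + k1` would also be stable, and then either it is `k1` and all products in `U`
vanish, or it is `S` and the products collapse (`false_of_stable_singular`). -/

set_option linter.unusedSimpArgs false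

/-! ### Zorn coordinates and the action of `sl₄` on the octonions. -/

namespace SplitOct

variable {k : Type*}

/-- The split octonion with Zorn coordinates `α, β` (diagonal), `v`, `p` (off-diagonal). -/
def zorn (α β v₁ v₂ v₃ p₁ p₂ p₃ : k) : SplitOct k := (!![α, v₁; p₁, β], !![v₂, p₃; v₃, p₂])

theorem eq_zorn (x : SplitOct k) :
    x = zorn (x.1 0 0) (x.1 1 1) (x.1 0 1) (x.2 0 0) (x.2 1 0) (x.1 1 0) (x.2 1 1) (x.2 0 1) := by
  refine Prod.ext ?_ ?_ <;> ext i j <;> fin_cases i <;> fin_cases j <;> rfl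

theorem zorn_inj {α β v₁ v₂ v₃ p₁ p₂ p₃ α' β' v₁' v₂' v₃' p₁' p₂' p₃' : k} :
    zorn α β v₁ v₂ v₃ p₁ p₂ p₃ = zorn α' β' v₁' v₂' v₃' p₁' p₂' p₃' ↔
      α = α' ∧ β = β' ∧ v₁ = v₁' ∧ v₂ = v₂' ∧ v₃ = v₃' ∧ p₁ = p₁' ∧ p₂ = p₂' ∧ p₃ = p₃' := by
  simp only [zorn, Prod.mk.injEq, ← Matrix.ext_iff, Fin.forall_fin_two]
  simp
  tauto

theorem exists_zorn (x : SplitOct k) :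
    ∃ α β v₁ v₂ v₃ p₁ p₂ p₃, x = zorn α β v₁ v₂ v₃ p₁ p₂ p₃ := ⟨_, _, _, _, _, _, _, _, eq_zorn x⟩

variable [Field k]

theorem zorn_add (α β v₁ v₂ v₃ p₁ p₂ p₃ α' β' v₁' v₂' v₃' p₁' p₂' p₃' : k) :
    zorn α β v₁ v₂ v₃ p₁ p₂ p₃ + zorn α' β' v₁' v₂' v₃' p₁' p₂' p₃' =
      zorn (α + α') (β + β') (v₁ + v₁') (v₂ + v₂') (v₃ + v₃') (p₁ + p₁') (p₂ + p₂') (p₃ + p₃') := by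
  simp [zorn]

theorem smul_zorn (c α β v₁ v₂ v₃ p₁ p₂ p₃ : k) :
    c • zorn α β v₁ v₂ v₃ p₁ p₂ p₃ =
      zorn (c * α) (c * β) (c * v₁) (c * v₂) (c * v₃) (c * p₁) (c * p₂) (c * p₃) := by
  simp [zorn]

theorem zero_eq_zorn : (0 : SplitOct k) = zorn 0 0 0 0 0 0 0 0 := by
  rw [eq_zorn (0 : SplitOct k)]; rfl

theorem zorn_mul [CharP k 2] (α β v₁ v₂ v₃ p₁ p₂ p₃ α' β' v₁' v₂' v₃' p₁' p₂' p₃' : k) :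
    mul (zorn α β v₁ v₂ v₃ p₁ p₂ p₃) (zorn α' β' v₁' v₂' v₃' p₁' p₂' p₃') =
      zorn (α * α' + v₁ * p₁' + v₂ * p₂' + v₃ * p₃') (β * β' + p₁ * v₁' + p₂ * v₂' + p₃ * v₃')
        (α * v₁' + β' * v₁ + p₂ * p₃' + p₃ * p₂') (α * v₂' + β' * v₂ + p₃ * p₁' + p₁ * p₃')
        (α * v₃' + β' * v₃ + p₁ * p₂' + p₂ * p₁')
        (α' * p₁ + β * p₁' + v₂ * v₃' + v₃ * v₂') (α' * p₂ + β * p₂' + v₃ * v₁' + v₁ * v₃')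
        (α' * p₃ + β * p₃' + v₁ * v₂' + v₂ * v₁') := by
  have h : ∀ a : k, -a = a := CharTwo.neg_eq
  rw [eq_zorn (mul _ _), zorn_inj]
  simp [mul, zorn, Matrix.adjugate_fin_two, h]
  refine ⟨?_, ?_, ?_, ?_, ?_, ?_, ?_, ?_⟩ <;> ring

/-- The unit. -/
def one : SplitOct k := zorn 1 1 0 0 0 0 0 0

/-- The trace. -/
def tr : SplitOct k →ₗ[k] k where
  toFun x := x.1 0 0 + x.1 1 1
  map_add' x y := by simp; ring
  map_smul' c x := by simp; ring

/-- The norm form (in characteristic two). -/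
def nrm (x : SplitOct k) : k :=
  x.1 0 0 * x.1 1 1 + x.1 0 1 * x.1 1 0 + x.2 0 0 * x.2 1 1 + x.2 1 0 * x.2 0 1

/-- The polar form of the norm. -/
def polar : LinearMap.BilinForm k (SplitOct k) :=
  LinearMap.mk₂ k (fun x y => x.1 0 0 * y.1 1 1 + x.1 1 1 * y.1 0 0 + x.1 0 1 * y.1 1 0 +
      x.1 1 0 * y.1 0 1 + x.2 0 0 * y.2 1 1 + x.2 1 1 * y.2 0 0 + x.2 1 0 * y.2 0 1 +
      x.2 0 1 * y.2 1 0)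
    (by intros; simp; ring) (by intros; simp; ring) (by intros; simp; ring) (by intros; simp; ring)

theorem tr_zorn (α β v₁ v₂ v₃ p₁ p₂ p₃ : k) : tr (zorn α β v₁ v₂ v₃ p₁ p₂ p₃) = α + β := rfl

theorem nrm_zorn (α β v₁ v₂ v₃ p₁ p₂ p₃ : k) :
    nrm (zorn α β v₁ v₂ v₃ p₁ p₂ p₃) = α * β + v₁ * p₁ + v₂ * p₂ + v₃ * p₃ := rfl

theorem polar_zorn (α β v₁ v₂ v₃ p₁ p₂ p₃ α' β' v₁' v₂' v₃' p₁' p₂' p₃' : k) :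
    polar (zorn α β v₁ v₂ v₃ p₁ p₂ p₃) (zorn α' β' v₁' v₂' v₃' p₁' p₂' p₃') =
      α * β' + β * α' + v₁ * p₁' + p₁ * v₁' + v₂ * p₂' + p₂ * v₂' + v₃ * p₃' + p₃ * v₃' := rfl

/-- The action of `4 × 4` matrices of trace zero on the split octonions in characteristic two by
derivations; scalar matrices act as zero. -/
def pslAct : Matrix (Fin 4) (Fin 4) k →ₗ[k] Module.End k (SplitOct k) :=
  LinearMap.mk₂ k (fun A x => zorn
      (A 0 3 * x.1 1 0 + A 1 3 * x.2 1 1 + A 2 3 * x.2 0 1 +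
        A 3 0 * x.1 0 1 + A 3 1 * x.2 0 0 + A 3 2 * x.2 1 0)
      (A 0 3 * x.1 1 0 + A 1 3 * x.2 1 1 + A 2 3 * x.2 0 1 +
        A 3 0 * x.1 0 1 + A 3 1 * x.2 0 0 + A 3 2 * x.2 1 0)
      ((A 0 0 + A 3 3) * x.1 0 1 + A 0 1 * x.2 0 0 + A 0 2 * x.2 1 0 +
        (x.1 0 0 + x.1 1 1) * A 0 3 + A 3 1 * x.2 0 1 + A 3 2 * x.2 1 1)
      (A 1 0 * x.1 0 1 + (A 1 1 + A 3 3) * x.2 0 0 + A 1 2 * x.2 1 0 +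
        (x.1 0 0 + x.1 1 1) * A 1 3 + A 3 2 * x.1 1 0 + A 3 0 * x.2 0 1)
      (A 2 0 * x.1 0 1 + A 2 1 * x.2 0 0 + (A 2 2 + A 3 3) * x.2 1 0 +
        (x.1 0 0 + x.1 1 1) * A 2 3 + A 3 0 * x.2 1 1 + A 3 1 * x.1 1 0)
      ((A 0 0 + A 3 3) * x.1 1 0 + A 1 0 * x.2 1 1 + A 2 0 * x.2 0 1 +
        (x.1 0 0 + x.1 1 1) * A 3 0 + A 1 3 * x.2 1 0 + A 2 3 * x.2 0 0)
      (A 0 1 * x.1 1 0 + (A 1 1 + A 3 3) * x.2 1 1 + A 2 1 * x.2 0 1 +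
        (x.1 0 0 + x.1 1 1) * A 3 1 + A 2 3 * x.1 0 1 + A 0 3 * x.2 1 0)
      (A 0 2 * x.1 1 0 + A 1 2 * x.2 1 1 + (A 2 2 + A 3 3) * x.2 0 1 +
        (x.1 0 0 + x.1 1 1) * A 3 2 + A 0 3 * x.2 0 0 + A 1 3 * x.1 0 1))
    (by intros; rw [zorn_add, zorn_inj]; simp; refine ⟨?_, ?_, ?_, ?_, ?_, ?_, ?_⟩ <;> ring)
    (by intros; rw [smul_zorn, zorn_inj]; simp; refine ⟨?_, ?_, ?_, ?_, ?_, ?_, ?_⟩ <;> ring)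
    (by intros; rw [zorn_add, zorn_inj]; simp; refine ⟨?_, ?_, ?_, ?_, ?_, ?_, ?_⟩ <;> ring)
    (by intros; rw [smul_zorn, zorn_inj]; simp; refine ⟨?_, ?_, ?_, ?_, ?_, ?_, ?_⟩ <;> ring)

theorem pslAct_zorn (A : Matrix (Fin 4) (Fin 4) k) (α β v₁ v₂ v₃ p₁ p₂ p₃ : k) :
    pslAct A (zorn α β v₁ v₂ v₃ p₁ p₂ p₃) = zorn
      (A 0 3 * p₁ + A 1 3 * p₂ + A 2 3 * p₃ + A 3 0 * v₁ + A 3 1 * v₂ + A 3 2 * v₃)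
      (A 0 3 * p₁ + A 1 3 * p₂ + A 2 3 * p₃ + A 3 0 * v₁ + A 3 1 * v₂ + A 3 2 * v₃)
      ((A 0 0 + A 3 3) * v₁ + A 0 1 * v₂ + A 0 2 * v₃ + (α + β) * A 0 3 + A 3 1 * p₃ + A 3 2 * p₂)
      (A 1 0 * v₁ + (A 1 1 + A 3 3) * v₂ + A 1 2 * v₃ + (α + β) * A 1 3 + A 3 2 * p₁ + A 3 0 * p₃)
      (A 2 0 * v₁ + A 2 1 * v₂ + (A 2 2 + A 3 3) * v₃ + (α + β) * A 2 3 + A 3 0 * p₂ + A 3 1 * p₁)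
      ((A 0 0 + A 3 3) * p₁ + A 1 0 * p₂ + A 2 0 * p₃ + (α + β) * A 3 0 + A 1 3 * v₃ + A 2 3 * v₂)
      (A 0 1 * p₁ + (A 1 1 + A 3 3) * p₂ + A 2 1 * p₃ + (α + β) * A 3 1 + A 2 3 * v₁ + A 0 3 * v₃)
      (A 0 2 * p₁ + A 1 2 * p₂ + (A 2 2 + A 3 3) * p₃ + (α + β) * A 3 2 + A 0 3 * v₂ + A 1 3 * v₁)
    := rfl

variable [CharP k 2]

/-- Modulo the unit, `v i` behaves as `e i ∧ e 4` and `p i` as the wedge of the two other vectors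
among `e 1, e 2, e 3`; signs play no role in characteristic two. The vanishing trace is used by
eliminating the last diagonal entry. -/
theorem pslAct_lie {A B : Matrix (Fin 4) (Fin 4) k} (hA : A.trace = 0) (hB : B.trace = 0) :
    pslAct ⁅A, B⁆ = ⁅pslAct A, pslAct B⁆ := by
  have h2 : (2 : k) = 0 := CharTwo.two_eq_zero
  have h : ∀ a b : k, a - b = a + b := CharTwo.sub_eq_add
  simp only [Matrix.trace, Matrix.diag, Fin.sum_univ_four] at hA hB
  refine LinearMap.ext fun x => ?_
  obtain ⟨α, β, v₁, v₂, v₃, p₁, p₂, p₃, rfl⟩ := exists_zorn x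
  rw [Ring.lie_def (pslAct A), LinearMap.sub_apply, Module.End.mul_apply, Module.End.mul_apply,
    sub_eq_add_neg, ← neg_one_smul k, CharTwo.neg_eq, one_smul]
  simp only [pslAct_zorn, zorn_add, zorn_inj, Ring.lie_def, Matrix.sub_apply, Matrix.mul_apply,
    Fin.sum_univ_four, h]
  have hA' : A 3 3 = A 0 0 + A 1 1 + A 2 2 := by grind
  have hB' : B 3 3 = B 0 0 + B 1 1 + B 2 2 := by grind
  simp only [hA', hB']
  refine ⟨?_, ?_, ?_, ?_, ?_, ?_, ?_, ?_⟩ <;> grind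

theorem pslAct_mul {A : Matrix (Fin 4) (Fin 4) k} (hA : A.trace = 0) (x y : SplitOct k) :
    pslAct A (mul x y) = mul (pslAct A x) y + mul x (pslAct A y) := by
  have h2 : (2 : k) = 0 := CharTwo.two_eq_zero
  simp only [Matrix.trace, Matrix.diag, Fin.sum_univ_four] at hA
  obtain ⟨α, β, v₁, v₂, v₃, p₁, p₂, p₃, rfl⟩ := exists_zorn x
  obtain ⟨α', β', v₁', v₂', v₃', p₁', p₂', p₃', rfl⟩ := exists_zorn y
  have hA' : A 3 3 = A 0 0 + A 1 1 + A 2 2 := by grind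
  simp only [pslAct_zorn, zorn_mul, zorn_add, zorn_inj, hA']
  refine ⟨?_, ?_, ?_, ?_, ?_, ?_, ?_, ?_⟩ <;> grind

end SplitOct

/-! ### Every derivation of the octonions comes from a traceless matrix. -/

namespace SplitOct

variable {k : Type*} [Field k]

/-- The derivations of the split octonion algebra. -/
def IsDer (D : Module.End k (SplitOct k)) : Prop :=
  ∀ x y, D (mul x y) = mul (D x) y + mul x (D y)

theorem zorn_eq_sum (α β v₁ v₂ v₃ p₁ p₂ p₃ : k) : zorn α β v₁ v₂ v₃ p₁ p₂ p₃ =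
    α • zorn 1 0 0 0 0 0 0 0 + β • zorn 0 1 0 0 0 0 0 0 + v₁ • zorn 0 0 1 0 0 0 0 0 +
    v₂ • zorn 0 0 0 1 0 0 0 0 + v₃ • zorn 0 0 0 0 1 0 0 0 + p₁ • zorn 0 0 0 0 0 1 0 0 +
    p₂ • zorn 0 0 0 0 0 0 1 0 + p₃ • zorn 0 0 0 0 0 0 0 1 := by
  simp [smul_zorn, zorn_add]

variable [CharP k 2]

/-- The Leibniz rule on products of basis vectors gives linear relations among the 64 coefficients
of `D`; these relations leave only the entries of a traceless matrix. -/
theorem IsDer.exists_pslAct {D : Module.End k (SplitOct k)} (hD : IsDer D) :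
    ∃ A : Matrix (Fin 4) (Fin 4) k, A.trace = 0 ∧ pslAct A = D := by
  have h2 : (2 : k) = 0 := CharTwo.two_eq_zero
  obtain ⟨a0, a1, a2, a3, a4, a5, a6, a7, ha⟩ := exists_zorn (D (zorn 1 0 0 0 0 0 0 0))
  obtain ⟨b0, b1, b2, b3, b4, b5, b6, b7, hb⟩ := exists_zorn (D (zorn 0 1 0 0 0 0 0 0))
  obtain ⟨c0, c1, c2, c3, c4, c5, c6, c7, hc⟩ := exists_zorn (D (zorn 0 0 1 0 0 0 0 0))
  obtain ⟨d0, d1, d2, d3, d4, d5, d6, d7, hd⟩ := exists_zorn (D (zorn 0 0 0 1 0 0 0 0))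
  obtain ⟨e0, e1, e2, e3, e4, e5, e6, e7, he⟩ := exists_zorn (D (zorn 0 0 0 0 1 0 0 0))
  obtain ⟨f0, f1, f2, f3, f4, f5, f6, f7, hf⟩ := exists_zorn (D (zorn 0 0 0 0 0 1 0 0))
  obtain ⟨g0, g1, g2, g3, g4, g5, g6, g7, hg⟩ := exists_zorn (D (zorn 0 0 0 0 0 0 1 0))
  obtain ⟨s0, s1, s2, s3, s4, s5, s6, s7, hh⟩ := exists_zorn (D (zorn 0 0 0 0 0 0 0 1))
  have D0 : D (zorn 0 0 0 0 0 0 0 0) = zorn 0 0 0 0 0 0 0 0 := by simp [← zero_eq_zorn]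
  have e11 := hD (zorn 1 0 0 0 0 0 0 0) (zorn 1 0 0 0 0 0 0 0)
  have e12 := hD (zorn 1 0 0 0 0 0 0 0) (zorn 0 1 0 0 0 0 0 0)
  have e21 := hD (zorn 0 1 0 0 0 0 0 0) (zorn 1 0 0 0 0 0 0 0)
  have e22 := hD (zorn 0 1 0 0 0 0 0 0) (zorn 0 1 0 0 0 0 0 0)
  have l1 := hD (zorn 1 0 0 0 0 0 0 0) (zorn 0 0 1 0 0 0 0 0)
  have l2 := hD (zorn 1 0 0 0 0 0 0 0) (zorn 0 0 0 1 0 0 0 0)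
  have l3 := hD (zorn 1 0 0 0 0 0 0 0) (zorn 0 0 0 0 1 0 0 0)
  have m1 := hD (zorn 0 0 1 0 0 0 0 0) (zorn 1 0 0 0 0 0 0 0)
  have m2 := hD (zorn 0 0 0 1 0 0 0 0) (zorn 1 0 0 0 0 0 0 0)
  have m3 := hD (zorn 0 0 0 0 1 0 0 0) (zorn 1 0 0 0 0 0 0 0)
  have n1 := hD (zorn 0 1 0 0 0 0 0 0) (zorn 0 0 0 0 0 1 0 0)
  have n2 := hD (zorn 0 1 0 0 0 0 0 0) (zorn 0 0 0 0 0 0 1 0)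
  have n3 := hD (zorn 0 1 0 0 0 0 0 0) (zorn 0 0 0 0 0 0 0 1)
  have o1 := hD (zorn 0 0 0 0 0 1 0 0) (zorn 0 1 0 0 0 0 0 0)
  have o2 := hD (zorn 0 0 0 0 0 0 1 0) (zorn 0 1 0 0 0 0 0 0)
  have o3 := hD (zorn 0 0 0 0 0 0 0 1) (zorn 0 1 0 0 0 0 0 0)
  have q11 := hD (zorn 0 0 1 0 0 0 0 0) (zorn 0 0 0 0 0 1 0 0)
  have q12 := hD (zorn 0 0 1 0 0 0 0 0) (zorn 0 0 0 0 0 0 1 0)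
  have q13 := hD (zorn 0 0 1 0 0 0 0 0) (zorn 0 0 0 0 0 0 0 1)
  have q21 := hD (zorn 0 0 0 1 0 0 0 0) (zorn 0 0 0 0 0 1 0 0)
  have q22 := hD (zorn 0 0 0 1 0 0 0 0) (zorn 0 0 0 0 0 0 1 0)
  have q23 := hD (zorn 0 0 0 1 0 0 0 0) (zorn 0 0 0 0 0 0 0 1)
  have q31 := hD (zorn 0 0 0 0 1 0 0 0) (zorn 0 0 0 0 0 1 0 0)
  have q32 := hD (zorn 0 0 0 0 1 0 0 0) (zorn 0 0 0 0 0 0 1 0)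
  have q33 := hD (zorn 0 0 0 0 1 0 0 0) (zorn 0 0 0 0 0 0 0 1)
  have r := hD (zorn 0 0 1 0 0 0 0 0) (zorn 0 0 0 1 0 0 0 0)
  simp only [zorn_mul, ha, hb, hc, hd, he, hf, hg, hh, zorn_add, mul_zero, zero_mul, mul_one,
    one_mul, add_zero, zero_add, D0, zorn_inj] at e11 e12 e21 e22 l1 l2 l3 m1 m2 m3
  simp only [zorn_mul, ha, hb, hc, hd, he, hf, hg, hh, zorn_add, mul_zero, zero_mul, mul_one,
    one_mul, add_zero, zero_add, D0, zorn_inj] at n1 n2 n3 o1 o2 o3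
  simp only [zorn_mul, ha, hb, hc, hd, he, hf, hg, hh, zorn_add, mul_zero, zero_mul, mul_one,
    one_mul, add_zero, zero_add, D0, zorn_inj] at q11 q12 q13 q21 q22 q23 q31 q32 q33 r
  -- The matrix is determined up to scalars, so its last diagonal entry may be taken to be 0. The
  -- last row and column are read off from `D` on a diagonal idempotent, the remaining block from
  -- `D` on the vectors `v i`.
  refine ⟨!![c2, d2, e2, a2; c3, d3, e3, a3; c4, d4, e4, a4; a5, a6, a7, 0], ?_, ?_⟩
  · simp [Matrix.trace, Fin.sum_univ_four]
    grind
  · refine LinearMap.ext fun x => ?_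
    obtain ⟨α, β, v₁, v₂, v₃, p₁, p₂, p₃, rfl⟩ := exists_zorn x
    have key := congrArg D (zorn_eq_sum α β v₁ v₂ v₃ p₁ p₂ p₃)
    simp only [map_add, map_smul] at key
    rw [key]
    simp only [ha, hb, hc, hd, he, hf, hg, hh, pslAct_zorn, smul_zorn, zorn_add,
      zorn_inj, Matrix.of_apply, Matrix.cons_val, Matrix.cons_val_zero, Matrix.cons_val_one]
    casesm* _ ∧ _
    refine ⟨?_, ?_, ?_, ?_, ?_, ?_, ?_, ?_⟩ <;> grind

end SplitOct

/-! ### Tangent spaces of linear groups. -/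

namespace LinAlgGroup

variable {k V : Type*} [Field k] [AddCommGroup V] [Module k V]

theorem mem_lieAlg {G : Subgroup (V ≃ₗ[k] V)} {x : Module.End k V} :
    x ∈ lieAlg G ↔ ∀ f, VanishesOn f G → evalAt 1 (dirDeriv x f) = 0 := Iff.rfl

/-- The tangent vector at `0` of a quadratic curve contained in `G` belongs to the Lie algebra. -/
theorem mem_lieAlg_of_curve [Infinite k] {G : Subgroup (V ≃ₗ[k] V)} {D E : Module.End k V}
    (h : ∀ t : k, ∃ g ∈ G, (g : Module.End k V) = 1 + t • D + t ^ 2 • E) : D ∈ lieAlg G := by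
  rw [mem_lieAlg]
  intro f hf
  -- Restriction of polynomial functions to the curve. A function vanishing on `G` restricts to a
  -- polynomial with every element of the infinite field as a root, hence to zero, and so does its
  -- derivative at 0.
  let c : MvPolynomial (Module.Dual k (Module.End k V)) k →ₐ[k] Polynomial k :=
    MvPolynomial.aeval fun φ => Polynomial.C (φ 1) + Polynomial.C (φ D) * Polynomial.X +
      Polynomial.C (φ E) * Polynomial.X ^ 2
  have hc : ∀ t p, (c p).eval t = evalAt (1 + t • D + t ^ 2 • E) p := by
    intro t p
    induction p using MvPolynomial.induction_on with
    | C a => simp [c, evalAt]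
    | add p q hp hq => simp [hp, hq]
    | mul_X p φ hp =>
      rw [map_mul, Polynomial.eval_mul, hp, map_mul]
      simp [c, evalAt]
      left; ring
  have hd : ∀ p, (c p).derivative.eval 0 = evalAt 1 (dirDeriv D p) := by
    intro p
    induction p using MvPolynomial.induction_on with
    | C a => simp [c, dirDeriv]
    | add p q hp hq => simp [hp, hq]
    | mul_X p φ hp =>
      have h0 := hc 0 p
      simp only [zero_smul, add_zero, zero_pow two_ne_zero] at h0
      rw [map_mul, Polynomial.derivative_mul, Polynomial.eval_add, Polynomial.eval_mul,
        Polynomial.eval_mul, hp, h0, Derivation.leibniz]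
      simp [c, evalAt, dirDeriv]
      ring
  have h0 : c f = 0 := by
    refine Polynomial.funext fun t => ?_
    obtain ⟨g, hg, e⟩ := h t
    rw [hc, ← e, hf g hg, Polynomial.eval_zero]
  rw [← hd, h0]
  simp

/-- A subspace stable under `G` is stable under its Lie algebra. -/
theorem apply_mem_of_mem_lieAlg {G : Subgroup (V ≃ₗ[k] V)} {U : Submodule k V}
    (h : ∀ g ∈ G, ∀ u ∈ U, g u ∈ U) {x : Module.End k V} (hx : x ∈ lieAlg G) {u : V}
    (hu : u ∈ U) : x u ∈ U := by
  rw [← Subspace.forall_mem_dualAnnihilator_apply_eq_zero_iff]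
  intro ℓ hℓ
  rw [Submodule.mem_dualAnnihilator] at hℓ
  -- For `ℓ` annihilating `U` and `u ∈ U`, the linear function `a ↦ ℓ (a u)` vanishes on `G` and is
  -- its own differential.
  have := mem_lieAlg.1 hx (MvPolynomial.X (ℓ ∘ₗ LinearMap.applyₗ u)) fun g hg => by
    simpa [evalAt] using hℓ _ (h g hg u hu)
  simpa [evalAt, dirDeriv] using this

/-- The Lie algebra of `G` is stable under conjugation by elements of `G`. -/
theorem conj_mem_lieAlg {G : Subgroup (V ≃ₗ[k] V)} {g : V ≃ₗ[k] V} (hg : g ∈ G)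
    {x : Module.End k V} (hx : x ∈ lieAlg G) :
    (g : Module.End k V) * x * ((g⁻¹ : V ≃ₗ[k] V) : Module.End k V) ∈ lieAlg G := by
  rw [mem_lieAlg]
  intro f hf
  let c : Module.Dual k (Module.End k V) → Module.Dual k (Module.End k V) := fun φ =>
    φ ∘ₗ LinearMap.mulLeft k (g : Module.End k V) ∘ₗ
      LinearMap.mulRight k ((g⁻¹ : V ≃ₗ[k] V) : Module.End k V)
  have hc : ∀ a p, evalAt a (MvPolynomial.rename c p) =
      evalAt ((g : Module.End k V) * a * ((g⁻¹ : V ≃ₗ[k] V) : Module.End k V)) p := by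
    intro a p
    simp [evalAt, MvPolynomial.aeval_rename, Function.comp_def, c, mul_assoc]
  have h1 : (g : Module.End k V) * 1 * ((g⁻¹ : V ≃ₗ[k] V) : Module.End k V) = 1 := by
    ext v
    exact g.apply_symm_apply v
  have hd : ∀ p, evalAt 1 (dirDeriv x (MvPolynomial.rename c p)) = evalAt 1 (dirDeriv
      ((g : Module.End k V) * x * ((g⁻¹ : V ≃ₗ[k] V) : Module.End k V)) p) := by
    intro p
    induction p using MvPolynomial.induction_on with
    | C a => simp [dirDeriv]
    | add p q hp hq => simp [hp, hq]
    | mul_X p φ hp =>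
      have h0 := hc 1
      rw [h1] at h0
      rw [map_mul, Derivation.leibniz, Derivation.leibniz, smul_eq_mul, smul_eq_mul, smul_eq_mul,
        smul_eq_mul, map_add, map_add, map_mul, map_mul, map_mul, map_mul, hp, h0, h0]
      simp [dirDeriv, c, evalAt, mul_assoc]
  rw [← hd]
  refine mem_lieAlg.1 hx _ fun a ha => ?_
  rw [hc]
  exact hf (g * a * g⁻¹) (G.mul_mem (G.mul_mem hg ha) (G.inv_mem hg))

theorem bilin_eq_sum_coord {ι : Type*} [Fintype ι] (B : Module.Basis ι k V) (m : V →ₗ[k] V →ₗ[k] V)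
    (ℓ : Module.Dual k V) (u v : V) :
    ℓ (m u v) = ∑ i, ∑ j, ℓ (m (B i) (B j)) * (B.coord i u * B.coord j v) := by
  conv_lhs => rw [← B.sum_repr u, ← B.sum_repr v]
  simp only [map_sum, LinearMap.sum_apply, map_smul, LinearMap.smul_apply, smul_eq_mul,
    Module.Basis.coord_apply, Finset.mul_sum]
  rw [Finset.sum_comm]
  refine Finset.sum_congr rfl fun i _ => Finset.sum_congr rfl fun j _ => ?_
  ring

/-- The Lie algebra of a group of automorphisms of an algebra consists of derivations. -/
theorem lieAlg_leibniz [FiniteDimensional k V] {G : Subgroup (V ≃ₗ[k] V)} {m : V →ₗ[k] V →ₗ[k] V}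
    (h : ∀ g ∈ G, ∀ x y, g (m x y) = m (g x) (g y)) {D : Module.End k V} (hD : D ∈ lieAlg G)
    (x y : V) : D (m x y) = m (D x) y + m x (D y) := by
  rw [← sub_eq_zero, ← Module.forall_dual_apply_eq_zero_iff k]
  intro ℓ
  obtain ⟨B⟩ : Nonempty (Module.Basis (Fin (Module.finrank k V)) k V) := ⟨Module.finBasis k V⟩
  have key := bilin_eq_sum_coord B m ℓ
  -- The function `a ↦ ℓ (a (x y)) - ℓ ((a x) (a y))`, written as a quadratic polynomial through a
  -- basis. Its differential at 1 is the Leibniz defect of `D`.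
  let f : MvPolynomial (Module.Dual k (Module.End k V)) k :=
    MvPolynomial.X (ℓ ∘ₗ LinearMap.applyₗ (m x y)) - ∑ i, ∑ j, MvPolynomial.C (ℓ (m (B i) (B j))) *
      (MvPolynomial.X (B.coord i ∘ₗ LinearMap.applyₗ x) *
        MvPolynomial.X (B.coord j ∘ₗ LinearMap.applyₗ y))
  have h1 : ∀ a : Module.End k V, evalAt a f = ℓ (a (m x y)) - ℓ (m (a x) (a y)) := by
    intro a
    rw [key (a x)]
    simp [f, evalAt]
  have h2 : evalAt 1 (dirDeriv D f) = ℓ (D (m x y)) - (ℓ (m (D x) y) + ℓ (m x (D y))) := by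
    rw [key (D x), key x, ← Finset.sum_add_distrib]
    simp only [← Finset.sum_add_distrib, f, map_sub, map_sum, Derivation.leibniz, smul_eq_mul,
      map_add, map_mul]
    simp only [dirDeriv, evalAt, MvPolynomial.mkDerivation_X, MvPolynomial.derivation_C,
      MvPolynomial.aeval_X, MvPolynomial.aeval_C, LinearMap.comp_apply, LinearMap.applyₗ_apply_apply,
      Algebra.algebraMap_self, RingHom.id_apply, Module.End.one_apply, map_zero, mul_zero, add_zero]
    congr 1
    refine Finset.sum_congr rfl fun i _ => Finset.sum_congr rfl fun j _ => ?_
    ring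
  rw [map_sub, map_add, ← h2]
  refine mem_lieAlg.1 hD f fun g hg => ?_
  rw [h1, sub_eq_zero]
  exact congrArg ℓ (h g hg x y)

end LinAlgGroup

/-! ### The Lie algebra of the group of type `G₂` is `psl₄`. -/

namespace SplitOct

open LinAlgGroup

variable {k : Type*} [Field k]

variable [CharP k 2]

/-- The multiplication as a bilinear map. -/
def mulₗ : SplitOct k →ₗ[k] SplitOct k →ₗ[k] SplitOct k :=
  LinearMap.mk₂ k mul
    (by
      intro x y z
      obtain ⟨α, β, v₁, v₂, v₃, p₁, p₂, p₃, rfl⟩ := exists_zorn x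
      obtain ⟨α', β', v₁', v₂', v₃', p₁', p₂', p₃', rfl⟩ := exists_zorn y
      obtain ⟨α'', β'', v₁'', v₂'', v₃'', p₁'', p₂'', p₃'', rfl⟩ := exists_zorn z
      simp only [zorn_mul, zorn_add, zorn_inj]
      refine ⟨?_, ?_, ?_, ?_, ?_, ?_, ?_, ?_⟩ <;> ring)
    (by
      intro c x y
      obtain ⟨α, β, v₁, v₂, v₃, p₁, p₂, p₃, rfl⟩ := exists_zorn x
      obtain ⟨α', β', v₁', v₂', v₃', p₁', p₂', p₃', rfl⟩ := exists_zorn y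
      simp only [zorn_mul, smul_zorn, zorn_inj]
      refine ⟨?_, ?_, ?_, ?_, ?_, ?_, ?_, ?_⟩ <;> ring)
    (by
      intro x y z
      obtain ⟨α, β, v₁, v₂, v₃, p₁, p₂, p₃, rfl⟩ := exists_zorn x
      obtain ⟨α', β', v₁', v₂', v₃', p₁', p₂', p₃', rfl⟩ := exists_zorn y
      obtain ⟨α'', β'', v₁'', v₂'', v₃'', p₁'', p₂'', p₃'', rfl⟩ := exists_zorn z
      simp only [zorn_mul, zorn_add, zorn_inj]
      refine ⟨?_, ?_, ?_, ?_, ?_, ?_, ?_, ?_⟩ <;> ring)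
    (by
      intro c x y
      obtain ⟨α, β, v₁, v₂, v₃, p₁, p₂, p₃, rfl⟩ := exists_zorn x
      obtain ⟨α', β', v₁', v₂', v₃', p₁', p₂', p₃', rfl⟩ := exists_zorn y
      simp only [zorn_mul, smul_zorn, zorn_inj]
      refine ⟨?_, ?_, ?_, ?_, ?_, ?_, ?_, ?_⟩ <;> ring)

theorem mulₗ_apply (x y : SplitOct k) : mulₗ x y = mul x y := rfl

omit [CharP k 2] in
theorem mem_groupG2 {g : SplitOct k ≃ₗ[k] SplitOct k} :
    g ∈ groupG2 k ↔ ∀ x y, g (mul x y) = mul (g x) (g y) := Iff.rfl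

theorem isDer_of_mem_lieAlg {D : Module.End k (SplitOct k)} (hD : D ∈ lieAlg (groupG2 k)) :
    IsDer D :=
  lieAlg_leibniz (m := mulₗ (k := k)) (fun _ hg => mem_groupG2.1 hg) hD

/-- The trace condition in characteristic two. -/
theorem trace_eq_zero_iff {A : Matrix (Fin 4) (Fin 4) k} :
    A.trace = 0 ↔ A 3 3 = A 0 0 + A 1 1 + A 2 2 := by
  simp only [Matrix.trace, Matrix.diag, Fin.sum_univ_four]
  rw [add_eq_zero_iff_eq_neg, CharTwo.neg_eq, eq_comm]

/-- The matrices with entries only in the last column, above the diagonal. -/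
def colMat (w₁ w₂ w₃ : k) : Matrix (Fin 4) (Fin 4) k :=
  !![0, 0, 0, w₁; 0, 0, 0, w₂; 0, 0, 0, w₃; 0, 0, 0, 0]

/-- The matrices with entries only in the last row, left of the diagonal. -/
def rowMat (w₁ w₂ w₃ : k) : Matrix (Fin 4) (Fin 4) k :=
  !![0, 0, 0, 0; 0, 0, 0, 0; 0, 0, 0, 0; w₁, w₂, w₃, 0]

omit [CharP k 2] in
theorem exists_mem_groupG2 {g : Module.End k (SplitOct k)} (h1 : g * g = 1)
    (h2 : ∀ x y, g (mul x y) = mul (g x) (g y)) :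
    ∃ a ∈ groupG2 k, (a : Module.End k (SplitOct k)) = g :=
  ⟨LinearEquiv.ofInvolutive g fun x => DFunLike.congr_fun h1 x, h2, rfl⟩

/-- For `D` the derivation and `w` the off-diagonal octonion with entries `w₁, w₂, w₃`, every `1 + t
D + t² ⟨w, ·⟩ w` is an automorphism of square one, and `D` is tangent to this curve at `t = 0`. -/
theorem pslAct_colMat_mem [Infinite k] (w₁ w₂ w₃ : k) :
    pslAct (colMat w₁ w₂ w₃) ∈ lieAlg (groupG2 k) := by
  have h2 : (2 : k) = 0 := CharTwo.two_eq_zero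
  let E : Module.End k (SplitOct k) := LinearMap.smulRight (polar (zorn 0 0 w₁ w₂ w₃ 0 0 0))
    (zorn 0 0 w₁ w₂ w₃ 0 0 0)
  refine mem_lieAlg_of_curve (E := E) fun t => exists_mem_groupG2 ?_ ?_
  · refine LinearMap.ext fun x => ?_
    obtain ⟨α, β, v₁, v₂, v₃, p₁, p₂, p₃, rfl⟩ := exists_zorn x
    simp [E, pslAct_zorn, smul_zorn, zorn_add, zorn_inj, polar_zorn, colMat]
    refine ⟨?_, ?_, ?_, ?_, ?_⟩ <;> grind
  · intro x y
    obtain ⟨α, β, v₁, v₂, v₃, p₁, p₂, p₃, rfl⟩ := exists_zorn x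
    obtain ⟨α', β', v₁', v₂', v₃', p₁', p₂', p₃', rfl⟩ := exists_zorn y
    simp [E, pslAct_zorn, smul_zorn, zorn_add, zorn_inj, zorn_mul, polar_zorn, colMat]
    refine ⟨?_, ?_, ?_, ?_, ?_, ?_, ?_, ?_⟩ <;> grind

theorem pslAct_rowMat_mem [Infinite k] (w₁ w₂ w₃ : k) :
    pslAct (rowMat w₁ w₂ w₃) ∈ lieAlg (groupG2 k) := by
  have h2 : (2 : k) = 0 := CharTwo.two_eq_zero
  let E : Module.End k (SplitOct k) := LinearMap.smulRight (polar (zorn 0 0 0 0 0 w₁ w₂ w₃))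
    (zorn 0 0 0 0 0 w₁ w₂ w₃)
  refine mem_lieAlg_of_curve (E := E) fun t => exists_mem_groupG2 ?_ ?_
  · refine LinearMap.ext fun x => ?_
    obtain ⟨α, β, v₁, v₂, v₃, p₁, p₂, p₃, rfl⟩ := exists_zorn x
    simp [E, pslAct_zorn, smul_zorn, zorn_add, zorn_inj, polar_zorn, rowMat]
    refine ⟨?_, ?_, ?_, ?_, ?_⟩ <;> grind
  · intro x y
    obtain ⟨α, β, v₁, v₂, v₃, p₁, p₂, p₃, rfl⟩ := exists_zorn x
    obtain ⟨α', β', v₁', v₂', v₃', p₁', p₂', p₃', rfl⟩ := exists_zorn y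
    simp [E, pslAct_zorn, smul_zorn, zorn_add, zorn_inj, zorn_mul, polar_zorn, rowMat]
    refine ⟨?_, ?_, ?_, ?_, ?_, ?_, ?_, ?_⟩ <;> grind

end SplitOct

theorem LieHom.nonempty_quotient_equiv {R L L' : Type*} [CommRing R] [LieRing L] [LieAlgebra R L]
    [LieRing L'] [LieAlgebra R L'] (f : L →ₗ⁅R⁆ L') (hf : Function.Surjective f) (I : LieIdeal R L)
    (hI : ∀ x, x ∈ I ↔ f x = 0) : Nonempty ((L ⧸ I) ≃ₗ⁅R⁆ L') := by
  obtain rfl : I = f.ker := by ext x; rw [hI, LieHom.mem_ker]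
  exact ⟨f.quotKerEquivRange.trans ((LieEquiv.ofEq _ _ (by rw [(LieHom.range_eq_top f).2 hf])).trans
    LieSubalgebra.topEquiv)⟩

namespace SplitOct

open LinAlgGroup

variable {k : Type*} [Field k] [CharP k 2]

theorem pslAct_mem_lieAlg [Infinite k] {A : Matrix (Fin 4) (Fin 4) k} (hA : A.trace = 0) :
    pslAct A ∈ lieAlg (groupG2 k) := by
  have hc : ∀ a b c : k, (colMat a b c).trace = 0 := by
    simp [colMat, Matrix.trace, Fin.sum_univ_four]
  have hr : ∀ a b c : k, (rowMat a b c).trace = 0 := by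
    simp [rowMat, Matrix.trace, Fin.sum_univ_four]
  -- The bracket of the `i`-th column vector with the `i`-th row of the upper block reproduces that
  -- row and puts `A i i` (up to sign) in the last diagonal place. These contributions add up to `A
  -- 3 3` since the trace is zero and signs are irrelevant.
  have e : A = ⁅colMat (k := k) 1 0 0, rowMat (A 0 0) (A 0 1) (A 0 2)⁆ +
      ⁅colMat (k := k) 0 1 0, rowMat (A 1 0) (A 1 1) (A 1 2)⁆ +
      ⁅colMat (k := k) 0 0 1, rowMat (A 2 0) (A 2 1) (A 2 2)⁆ +
      colMat (A 0 3) (A 1 3) (A 2 3) + rowMat (A 3 0) (A 3 1) (A 3 2) := by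
    have h : ∀ a : k, -a = a := CharTwo.neg_eq
    rw [trace_eq_zero_iff] at hA
    ext i j
    fin_cases i <;> fin_cases j <;> simp [colMat, rowMat, Ring.lie_def, Matrix.mul_apply,
      Fin.sum_univ_four, hA, h]
  rw [e]
  simp only [map_add]
  have hb : ∀ a b c a' b' c' : k, pslAct ⁅colMat a b c, rowMat a' b' c'⁆ ∈ lieAlg (groupG2 k) := by
    intros
    rw [pslAct_lie (hc _ _ _) (hr _ _ _)]
    exact LieSubalgebra.lie_mem _ (pslAct_colMat_mem _ _ _) (pslAct_rowMat_mem _ _ _)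
  exact add_mem (add_mem (add_mem (add_mem (hb _ _ _ _ _ _) (hb _ _ _ _ _ _)) (hb _ _ _ _ _ _))
    (pslAct_colMat_mem _ _ _)) (pslAct_rowMat_mem _ _ _)

theorem mem_lieAlg_groupG2_iff [Infinite k] {D : Module.End k (SplitOct k)} :
    D ∈ lieAlg (groupG2 k) ↔ ∃ A : Matrix (Fin 4) (Fin 4) k, A.trace = 0 ∧ pslAct A = D := by
  refine ⟨fun h => (isDer_of_mem_lieAlg h).exists_pslAct, ?_⟩
  rintro ⟨A, hA, rfl⟩
  exact pslAct_mem_lieAlg hA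

/-- The traceless octonions modulo scalars are a faithful module for the derivations. -/
theorem exists_eq_smul_one_of_pslAct {A : Matrix (Fin 4) (Fin 4) k}
    (h : ∀ x, tr x = 0 → ∃ c : k, pslAct A x = c • one) : ∃ c : k, A = c • 1 := by
  obtain ⟨c1, h1⟩ := h (zorn 0 0 1 0 0 0 0 0) (by simp [tr_zorn])
  obtain ⟨c2, h2⟩ := h (zorn 0 0 0 1 0 0 0 0) (by simp [tr_zorn])
  obtain ⟨c3, h3⟩ := h (zorn 0 0 0 0 1 0 0 0) (by simp [tr_zorn])
  obtain ⟨c4, h4⟩ := h (zorn 0 0 0 0 0 1 0 0) (by simp [tr_zorn])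
  obtain ⟨c5, h5⟩ := h (zorn 0 0 0 0 0 0 1 0) (by simp [tr_zorn])
  simp [pslAct_zorn, one, smul_zorn, zorn_inj] at h1 h2 h3 h4 h5
  casesm* _ ∧ _
  refine ⟨A 3 3, ?_⟩
  have e : ∀ a b : k, a + b = 0 → a = b := fun a b h => by
    rwa [add_eq_zero_iff_eq_neg, CharTwo.neg_eq] at h
  ext i j
  fin_cases i <;> fin_cases j <;> simp <;> first | assumption | (apply e; assumption)

theorem pslAct_smul_one (c : k) : pslAct (c • (1 : Matrix (Fin 4) (Fin 4) k)) = 0 := by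
  have h : ∀ a : k, a + a = 0 := CharTwo.add_self_eq_zero
  refine LinearMap.ext fun x => ?_
  obtain ⟨α, β, v₁, v₂, v₃, p₁, p₂, p₃, rfl⟩ := exists_zorn x
  rw [LinearMap.zero_apply, zero_eq_zorn, pslAct_zorn]
  simp [zorn_inj, h]

theorem pslAct_eq_zero_iff {A : Matrix (Fin 4) (Fin 4) k} :
    pslAct A = 0 ↔ ∃ c : k, A = c • 1 := by
  refine ⟨fun h => exists_eq_smul_one_of_pslAct fun x _ => ⟨0, by simp [h]⟩, ?_⟩
  rintro ⟨c, rfl⟩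
  exact pslAct_smul_one c

/-- Traceless matrices act on the split octonions through the Lie algebra of `G₂`. -/
def slToG2 [Infinite k] : LieAlgebra.SpecialLinear.sl (Fin 4) k →ₗ⁅k⁆ lieAlg (groupG2 k) where
  toFun A := ⟨pslAct A.1, pslAct_mem_lieAlg A.2⟩
  map_add' A B := Subtype.ext (map_add pslAct A.1 B.1)
  map_smul' c A := Subtype.ext (map_smul pslAct c A.1)
  map_lie' {A B} := Subtype.ext (pslAct_lie A.2 B.2)

theorem slToG2_surjective [Infinite k] : Function.Surjective (slToG2 (k := k)) := by
  rintro ⟨D, hD⟩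
  obtain ⟨A, hA, rfl⟩ := mem_lieAlg_groupG2_iff.1 hD
  exact ⟨⟨A, hA⟩, rfl⟩

theorem nonempty_psl_equiv [Infinite k] : Nonempty (psl 4 k ≃ₗ⁅k⁆ lieAlg (groupG2 k)) :=
  slToG2.nonempty_quotient_equiv slToG2_surjective _ fun A => by
    rw [Subtype.ext_iff]
    exact pslAct_eq_zero_iff.symm

/-- The isomorphism `sl(V) ≅ sl₄` given by a basis. -/
noncomputable def slEndToSl {V : Type*} [AddCommGroup V] [Module k V]
    (b : Module.Basis (Fin 4) k V) : slEnd k V →ₗ⁅k⁆ LieAlgebra.SpecialLinear.sl (Fin 4) k where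
  toFun x := ⟨LinearMap.toMatrixAlgEquiv b x.1,
    (LinearMap.trace_eq_matrix_trace k b x.1).symm.trans x.2⟩
  map_add' x y := Subtype.ext (map_add (LinearMap.toMatrixAlgEquiv b) x.1 y.1)
  map_smul' c x := Subtype.ext (map_smul (LinearMap.toMatrixAlgEquiv b) c x.1)
  map_lie' {x y} := Subtype.ext (by
    simp [Ring.lie_def])

theorem nonempty_pslEnd_equiv [Infinite k] {V : Type*} [AddCommGroup V] [Module k V]
    (b : Module.Basis (Fin 4) k V) : Nonempty (pslEnd k V ≃ₗ⁅k⁆ lieAlg (groupG2 k)) := by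
  refine (slToG2.comp (slEndToSl b)).nonempty_quotient_equiv
    (slToG2_surjective.comp fun A => ⟨⟨(LinearMap.toMatrixAlgEquiv b).symm A.1, ?_⟩, ?_⟩) _ fun x => ?_
  · have := LinearMap.trace_eq_matrix_trace k b ((LinearMap.toMatrixAlgEquiv b).symm A.1)
    refine this.trans ((congrArg Matrix.trace ?_).trans A.2)
    exact (LinearMap.toMatrixAlgEquiv b).apply_symm_apply A.1
  · exact Subtype.ext ((LinearMap.toMatrixAlgEquiv b).apply_symm_apply A.1)
  · rw [Subtype.ext_iff]
    refine Iff.trans ?_ pslAct_eq_zero_iff.symm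
    refine exists_congr fun c => ?_
    rw [← (LinearMap.toMatrixAlgEquiv b).injective.eq_iff]
    simp [slEndToSl]

end SplitOct

/-! ### Norm, polar form and alternative identities of the octonions. -/

namespace SplitOct

open LinAlgGroup

variable {k : Type*} [Field k]

theorem polar_comm (x y : SplitOct k) : polar x y = polar y x := by
  obtain ⟨α, β, v₁, v₂, v₃, p₁, p₂, p₃, rfl⟩ := exists_zorn x
  obtain ⟨α', β', v₁', v₂', v₃', p₁', p₂', p₃', rfl⟩ := exists_zorn y
  simp only [polar_zorn]
  ring

theorem polar_one (x : SplitOct k) : polar x one = tr x := by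
  obtain ⟨α, β, v₁, v₂, v₃, p₁, p₂, p₃, rfl⟩ := exists_zorn x
  simp [polar_zorn, tr_zorn, one]

theorem polar_nondegenerate : (polar (k := k)).Nondegenerate := by
  have : ∀ x : SplitOct k, (∀ y, polar x y = 0) → x = 0 := by
    intro x h
    obtain ⟨α, β, v₁, v₂, v₃, p₁, p₂, p₃, rfl⟩ := exists_zorn x
    have h1 := h (zorn 1 0 0 0 0 0 0 0)
    have h2 := h (zorn 0 1 0 0 0 0 0 0)
    have h3 := h (zorn 0 0 1 0 0 0 0 0)
    have h4 := h (zorn 0 0 0 1 0 0 0 0)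
    have h5 := h (zorn 0 0 0 0 1 0 0 0)
    have h6 := h (zorn 0 0 0 0 0 1 0 0)
    have h7 := h (zorn 0 0 0 0 0 0 1 0)
    have h8 := h (zorn 0 0 0 0 0 0 0 1)
    simp [polar_zorn] at h1 h2 h3 h4 h5 h6 h7 h8
    simp [zero_eq_zorn, zorn_inj, *]
  exact ⟨this, fun x h => this x fun y => by rw [polar_comm, h]⟩

theorem nrm_add (x y : SplitOct k) : nrm (x + y) = nrm x + nrm y + polar x y := by
  obtain ⟨α, β, v₁, v₂, v₃, p₁, p₂, p₃, rfl⟩ := exists_zorn x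
  obtain ⟨α', β', v₁', v₂', v₃', p₁', p₂', p₃', rfl⟩ := exists_zorn y
  simp only [polar_zorn, zorn_add, nrm_zorn]
  ring

theorem nrm_smul (c : k) (x : SplitOct k) : nrm (c • x) = c ^ 2 * nrm x := by
  obtain ⟨α, β, v₁, v₂, v₃, p₁, p₂, p₃, rfl⟩ := exists_zorn x
  simp only [smul_zorn, nrm_zorn]
  ring

theorem nrm_one : nrm (one : SplitOct k) = 1 := by simp [one, nrm_zorn]

theorem one_ne_zero : (one : SplitOct k) ≠ 0 := by simp [one, zero_eq_zorn, zorn_inj]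

theorem polar_smul_one (x : SplitOct k) (c : k) : polar x (c • one) = c * tr x := by
  rw [map_smul, polar_one, smul_eq_mul]

variable [CharP k 2]

theorem tr_one : tr (one : SplitOct k) = 0 := by simp [one, tr_zorn, CharTwo.add_self_eq_zero]

theorem one_mul (x : SplitOct k) : mul one x = x := by
  obtain ⟨α, β, v₁, v₂, v₃, p₁, p₂, p₃, rfl⟩ := exists_zorn x
  simp [one, zorn_mul, zorn_inj]

theorem mul_one (x : SplitOct k) : mul x one = x := by
  obtain ⟨α, β, v₁, v₂, v₃, p₁, p₂, p₃, rfl⟩ := exists_zorn x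
  simp [one, zorn_mul, zorn_inj]

theorem mul_self (x : SplitOct k) : mul x x = tr x • x + nrm x • one := by
  have h2 : (2 : k) = 0 := CharTwo.two_eq_zero
  obtain ⟨α, β, v₁, v₂, v₃, p₁, p₂, p₃, rfl⟩ := exists_zorn x
  simp only [one, zorn_mul, zorn_inj, smul_zorn, zorn_add, tr_zorn, nrm_zorn]
  refine ⟨?_, ?_, ?_, ?_, ?_, ?_, ?_, ?_⟩ <;> grind

theorem nrm_mul (x y : SplitOct k) : nrm (mul x y) = nrm x * nrm y := by
  have h2 : (2 : k) = 0 := CharTwo.two_eq_zero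
  obtain ⟨α, β, v₁, v₂, v₃, p₁, p₂, p₃, rfl⟩ := exists_zorn x
  obtain ⟨α', β', v₁', v₂', v₃', p₁', p₂', p₃', rfl⟩ := exists_zorn y
  simp only [zorn_mul, nrm_zorn]
  grind

theorem mul_add_mul_comm (x y : SplitOct k) :
    mul x y + mul y x = tr x • y + tr y • x + polar x y • one := by
  have h2 : (2 : k) = 0 := CharTwo.two_eq_zero
  obtain ⟨α, β, v₁, v₂, v₃, p₁, p₂, p₃, rfl⟩ := exists_zorn x
  obtain ⟨α', β', v₁', v₂', v₃', p₁', p₂', p₃', rfl⟩ := exists_zorn y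
  simp only [one, zorn_mul, zorn_inj, smul_zorn, zorn_add, tr_zorn, polar_zorn]
  refine ⟨?_, ?_, ?_, ?_, ?_, ?_, ?_, ?_⟩ <;> grind

theorem mul_mul_self_left (x y : SplitOct k) :
    mul x (mul x y) = tr x • mul x y + nrm x • y := by
  have h2 : (2 : k) = 0 := CharTwo.two_eq_zero
  obtain ⟨α, β, v₁, v₂, v₃, p₁, p₂, p₃, rfl⟩ := exists_zorn x
  obtain ⟨α', β', v₁', v₂', v₃', p₁', p₂', p₃', rfl⟩ := exists_zorn y
  simp only [zorn_mul, zorn_inj, smul_zorn, zorn_add, tr_zorn, nrm_zorn]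
  refine ⟨?_, ?_, ?_, ?_, ?_, ?_, ?_, ?_⟩ <;> grind

theorem tr_mul (x y : SplitOct k) : tr (mul x y) = polar x y + tr x * tr y := by
  have h2 : (2 : k) = 0 := CharTwo.two_eq_zero
  obtain ⟨α, β, v₁, v₂, v₃, p₁, p₂, p₃, rfl⟩ := exists_zorn x
  obtain ⟨α', β', v₁', v₂', v₃', p₁', p₂', p₃', rfl⟩ := exists_zorn y
  simp only [zorn_mul, tr_zorn, polar_zorn]
  grind

theorem polar_mul_left (x y z : SplitOct k) :
    polar x (mul y z) = polar (mul y x) z + tr y * polar x z := by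
  have h2 : (2 : k) = 0 := CharTwo.two_eq_zero
  obtain ⟨α, β, v₁, v₂, v₃, p₁, p₂, p₃, rfl⟩ := exists_zorn x
  obtain ⟨α', β', v₁', v₂', v₃', p₁', p₂', p₃', rfl⟩ := exists_zorn y
  obtain ⟨α'', β'', v₁'', v₂'', v₃'', p₁'', p₂'', p₃'', rfl⟩ := exists_zorn z
  simp only [zorn_mul, tr_zorn, polar_zorn]
  grind

theorem mul_mul_add_right (x a y : SplitOct k) (hy : tr y = 0) :
    mul (mul x a) y + mul (mul x y) a = polar a y • x + tr a • mul x y := by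
  have h2 : (2 : k) = 0 := CharTwo.two_eq_zero
  obtain ⟨α, β, v₁, v₂, v₃, p₁, p₂, p₃, rfl⟩ := exists_zorn x
  obtain ⟨α', β', v₁', v₂', v₃', p₁', p₂', p₃', rfl⟩ := exists_zorn y
  obtain ⟨α'', β'', v₁'', v₂'', v₃'', p₁'', p₂'', p₃'', rfl⟩ := exists_zorn a
  rw [tr_zorn, add_eq_zero_iff_eq_neg, CharTwo.neg_eq] at hy
  subst hy
  simp only [zorn_mul, zorn_inj, smul_zorn, zorn_add, tr_zorn, polar_zorn]
  refine ⟨?_, ?_, ?_, ?_, ?_, ?_, ?_, ?_⟩ <;> grind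

theorem mul_mul_add_left (y c z : SplitOct k) (hy : tr y = 0) :
    mul y (mul c z) + mul c (mul y z) = polar y c • z + tr c • mul y z := by
  have h2 : (2 : k) = 0 := CharTwo.two_eq_zero
  obtain ⟨α, β, v₁, v₂, v₃, p₁, p₂, p₃, rfl⟩ := exists_zorn c
  obtain ⟨α', β', v₁', v₂', v₃', p₁', p₂', p₃', rfl⟩ := exists_zorn y
  obtain ⟨α'', β'', v₁'', v₂'', v₃'', p₁'', p₂'', p₃'', rfl⟩ := exists_zorn z
  rw [tr_zorn, add_eq_zero_iff_eq_neg, CharTwo.neg_eq] at hy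
  subst hy
  simp only [zorn_mul, zorn_inj, smul_zorn, zorn_add, tr_zorn, polar_zorn]
  refine ⟨?_, ?_, ?_, ?_, ?_, ?_, ?_, ?_⟩ <;> grind

/-- The middle Moufang identity. -/
theorem moufang_middle (e d z : SplitOct k) :
    mul (mul e d) (mul z e) = mul (mul e (mul d z)) e := by
  have h2 : (2 : k) = 0 := CharTwo.two_eq_zero
  obtain ⟨α, β, v₁, v₂, v₃, p₁, p₂, p₃, rfl⟩ := exists_zorn d
  obtain ⟨α', β', v₁', v₂', v₃', p₁', p₂', p₃', rfl⟩ := exists_zorn e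
  obtain ⟨α'', β'', v₁'', v₂'', v₃'', p₁'', p₂'', p₃'', rfl⟩ := exists_zorn z
  simp only [zorn_mul, zorn_inj]
  refine ⟨?_, ?_, ?_, ?_, ?_, ?_, ?_, ?_⟩ <;> grind

theorem mul_mul_self_right (e w : SplitOct k) (he : nrm e = 0) :
    mul (mul e w) e = (polar e w + tr e * tr w) • e := by
  have h2 : (2 : k) = 0 := CharTwo.two_eq_zero
  obtain ⟨α, β, v₁, v₂, v₃, p₁, p₂, p₃, rfl⟩ := exists_zorn e
  obtain ⟨α', β', v₁', v₂', v₃', p₁', p₂', p₃', rfl⟩ := exists_zorn w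
  rw [nrm_zorn] at he
  simp only [zorn_mul, zorn_inj, smul_zorn, tr_zorn, polar_zorn]
  refine ⟨?_, ?_, ?_, ?_, ?_, ?_, ?_, ?_⟩ <;> grind

theorem pslAct_one (A : Matrix (Fin 4) (Fin 4) k) : pslAct A one = 0 := by
  have h : (1 : k) + 1 = 0 := CharTwo.add_self_eq_zero 1
  simp [one, pslAct_zorn, zero_eq_zorn, zorn_inj, h]

theorem tr_pslAct (A : Matrix (Fin 4) (Fin 4) k) (x : SplitOct k) : tr (pslAct A x) = 0 := by
  obtain ⟨α, β, v₁, v₂, v₃, p₁, p₂, p₃, rfl⟩ := exists_zorn x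
  rw [pslAct_zorn, tr_zorn, CharTwo.add_self_eq_zero]

/-- This is the infinitesimal invariance of the polar form; in characteristic two, skew and
self-adjoint coincide. It makes orthogonal complements of stable subspaces stable. -/
theorem polar_pslAct {A : Matrix (Fin 4) (Fin 4) k} (x y : SplitOct k) :
    polar (pslAct A x) y = polar x (pslAct A y) := by
  have h2 : (2 : k) = 0 := CharTwo.two_eq_zero
  obtain ⟨α, β, v₁, v₂, v₃, p₁, p₂, p₃, rfl⟩ := exists_zorn x
  obtain ⟨α', β', v₁', v₂', v₃', p₁', p₂', p₃', rfl⟩ := exists_zorn y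
  simp only [pslAct_zorn, polar_zorn]
  grind

/-- The stabilizer in the Lie algebra of a traceless octonion modulo scalars has codimension at
least four. -/
theorem exists_four_dim_complement {x : SplitOct k} (hx : tr x = 0) (hx1 : ∀ c : k, x ≠ c • one) :
    ∃ m : (Fin 4 → k) →ₗ[k] Matrix (Fin 4) (Fin 4) k, (∀ c, (m c).trace = 0) ∧
      ∀ c, ∀ d : k, pslAct (m c) x = d • one → c = 0 := by
  have h2 : (2 : k) = 0 := CharTwo.two_eq_zero
  obtain ⟨α, β, v₁, v₂, v₃, p₁, p₂, p₃, rfl⟩ := exists_zorn x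
  rw [tr_zorn, add_eq_zero_iff_eq_neg, CharTwo.neg_eq] at hx
  subst hx
  have hv : v₁ ≠ 0 ∨ v₂ ≠ 0 ∨ v₃ ≠ 0 ∨ p₁ ≠ 0 ∨ p₂ ≠ 0 ∨ p₃ ≠ 0 := by
    by_contra! h
    refine hx1 α ?_
    simp [one, smul_zorn, zorn_inj, h]
  rcases hv with h | h | h | h | h | h
  -- The four free entries are placed so that four off-diagonal coordinates of the image are exactly
  -- the nonzero coordinate `v₁` times one of the entries each. The other five cases follow the same
  -- pattern.
  · refine ⟨IsLinearMap.mk' (fun c => !![0, 0, 0, 0; c 0, 0, 0, c 1; c 2, 0, 0, c 3; 0, 0, 0, 0])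
      ⟨fun c d => by ext i j; fin_cases i <;> fin_cases j <;> simp,
        fun a c => by ext i j; fin_cases i <;> fin_cases j <;> simp⟩,
      fun c => by simp [Matrix.trace, Fin.sum_univ_four], fun c d hc => ?_⟩
    simp [pslAct_zorn, one, smul_zorn, zorn_inj] at hc
    funext i
    fin_cases i <;> simp <;> grind
  · refine ⟨IsLinearMap.mk' (fun c => !![0, c 0, 0, c 1; 0, 0, 0, 0; 0, c 2, 0, c 3; 0, 0, 0, 0])
      ⟨fun c d => by ext i j; fin_cases i <;> fin_cases j <;> simp,
        fun a c => by ext i j; fin_cases i <;> fin_cases j <;> simp⟩,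
      fun c => by simp [Matrix.trace, Fin.sum_univ_four], fun c d hc => ?_⟩
    simp [pslAct_zorn, one, smul_zorn, zorn_inj] at hc
    funext i
    fin_cases i <;> simp <;> grind
  · refine ⟨IsLinearMap.mk' (fun c => !![0, 0, c 0, c 1; 0, 0, c 2, c 3; 0, 0, 0, 0; 0, 0, 0, 0])
      ⟨fun c d => by ext i j; fin_cases i <;> fin_cases j <;> simp,
        fun a c => by ext i j; fin_cases i <;> fin_cases j <;> simp⟩,
      fun c => by simp [Matrix.trace, Fin.sum_univ_four], fun c d hc => ?_⟩
    simp [pslAct_zorn, one, smul_zorn, zorn_inj] at hc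
    funext i
    fin_cases i <;> simp <;> grind
  · refine ⟨IsLinearMap.mk' (fun c => !![0, c 0, c 1, 0; 0, 0, 0, 0; 0, 0, 0, 0; 0, c 2, c 3, 0])
      ⟨fun c d => by ext i j; fin_cases i <;> fin_cases j <;> simp,
        fun a c => by ext i j; fin_cases i <;> fin_cases j <;> simp⟩,
      fun c => by simp [Matrix.trace, Fin.sum_univ_four], fun c d hc => ?_⟩
    simp [pslAct_zorn, one, smul_zorn, zorn_inj] at hc
    funext i
    fin_cases i <;> simp <;> grind
  · refine ⟨IsLinearMap.mk' (fun c => !![0, 0, 0, 0; c 0, 0, c 1, 0; 0, 0, 0, 0; c 2, 0, c 3, 0])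
      ⟨fun c d => by ext i j; fin_cases i <;> fin_cases j <;> simp,
        fun a c => by ext i j; fin_cases i <;> fin_cases j <;> simp⟩,
      fun c => by simp [Matrix.trace, Fin.sum_univ_four], fun c d hc => ?_⟩
    simp [pslAct_zorn, one, smul_zorn, zorn_inj] at hc
    funext i
    fin_cases i <;> simp <;> grind
  · refine ⟨IsLinearMap.mk' (fun c => !![0, 0, 0, 0; 0, 0, 0, 0; c 0, c 1, 0, 0; c 2, c 3, 0, 0])
      ⟨fun c d => by ext i j; fin_cases i <;> fin_cases j <;> simp,
        fun a c => by ext i j; fin_cases i <;> fin_cases j <;> simp⟩,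
      fun c => by simp [Matrix.trace, Fin.sum_univ_four], fun c d hc => ?_⟩
    simp [pslAct_zorn, one, smul_zorn, zorn_inj] at hc
    funext i
    fin_cases i <;> simp <;> grind

variable {g : SplitOct k ≃ₗ[k] SplitOct k} (hg : g ∈ groupG2 k)
include hg

theorem map_one : g one = one := by
  have h := mem_groupG2.1 hg (g.symm one) one
  rw [mul_one, g.apply_symm_apply, one_mul] at h
  exact h.symm

/-- Trace and norm are the coefficients of the quadratic equation satisfied by `x`, which are unique
when `x` is not a scalar; an automorphism preserves the equation. -/
theorem tr_nrm_map (x : SplitOct k) : tr (g x) = tr x ∧ nrm (g x) = nrm x := by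
  by_cases hx : ∃ c : k, x = c • one
  · obtain ⟨c, rfl⟩ := hx
    rw [map_smul, map_one hg]
    exact ⟨rfl, rfl⟩
  · have h := mem_groupG2.1 hg x x
    rw [mul_self, mul_self, map_add, map_smul, map_smul, map_one hg] at h
    have hgx : ∀ c : k, g x ≠ c • one := fun c hc => hx ⟨c, g.injective (by
      rw [hc, map_smul, map_one hg])⟩
    have h3 : (tr x - tr (g x)) • g x = (nrm (g x) - nrm x) • one := by
      rw [sub_smul, sub_smul]
      rw [sub_eq_sub_iff_add_eq_add, h]
      abel
    have h4 : tr x - tr (g x) = 0 := by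
      by_contra h4
      refine hgx ((tr x - tr (g x))⁻¹ * (nrm (g x) - nrm x)) ?_
      rw [mul_smul, ← h3, smul_smul, inv_mul_cancel₀ h4, one_smul]
    rw [h4, zero_smul, eq_comm, smul_eq_zero, or_iff_left one_ne_zero] at h3
    exact ⟨(sub_eq_zero.1 h4).symm, sub_eq_zero.1 h3⟩

end SplitOct

/-! ### The truncated polynomial algebra and its first-order operators. -/

/-- A presentation of a commutative algebra as `k[X, Y]/(X², Y²)`, with its partial derivatives. -/
structure TruncData (k A : Type*) [Field k] [CommRing A] [Algebra k A] where
  x : A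
  y : A
  x_mul_x : x * x = 0
  y_mul_y : y * y = 0
  exists_eq : ∀ f : A, ∃ a b c d : k, f = a • 1 + b • x + c • y + d • (x * y)
  aug : A →ₐ[k] k
  aug_x : aug x = 0
  aug_y : aug y = 0
  dx : Derivation k A A
  dy : Derivation k A A
  dx_x : dx x = 1
  dx_y : dx y = 0
  dy_x : dy x = 0
  dy_y : dy y = 1

namespace TruncData

variable {k A : Type*} [Field k] [CommRing A] [Algebra k A] (T : TruncData k A)

/-- The element `a + b x + c y + d x y`. -/
def comb (a b c d : k) : A := a • 1 + b • T.x + c • T.y + d • (T.x * T.y)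

theorem comb_add (a b c d a' b' c' d' : k) :
    T.comb a b c d + T.comb a' b' c' d' = T.comb (a + a') (b + b') (c + c') (d + d') := by
  simp only [comb, add_smul]; abel

theorem smul_comb (r a b c d : k) : r • T.comb a b c d = T.comb (r * a) (r * b) (r * c) (r * d) := by
  simp only [comb, smul_add, mul_smul]

theorem comb_mul (a b c d a' b' c' d' : k) : T.comb a b c d * T.comb a' b' c' d' =
    T.comb (a * a') (a * b' + b * a') (a * c' + c * a') (a * d' + d * a' + b * c' + c * b') := by
  have h0 := T.x_mul_x
  have h1 := T.y_mul_y
  simp only [comb, Algebra.smul_def, map_add, map_mul]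
  grind

theorem one_eq : (1 : A) = T.comb 1 0 0 0 := by simp [comb]
theorem zero_eq : (0 : A) = T.comb 0 0 0 0 := by simp [comb]
theorem x_eq : T.x = T.comb 0 1 0 0 := by simp [comb]
theorem y_eq : T.y = T.comb 0 0 1 0 := by simp [comb]

theorem exists_comb (f : A) : ∃ a b c d, f = T.comb a b c d := T.exists_eq f

theorem aug_comb (a b c d : k) : T.aug (T.comb a b c d) = a := by
  simp [comb, T.aug_x, T.aug_y]

theorem dx_comb (a b c d : k) : T.dx (T.comb a b c d) = T.comb b 0 d 0 := by
  simp [comb, T.dx_x, T.dx_y]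

theorem dy_comb (a b c d : k) : T.dy (T.comb a b c d) = T.comb c d 0 0 := by
  simp [comb, T.dy_x, T.dy_y]

/-- Each coefficient is recovered by differentiating and then augmenting. -/
theorem comb_inj {a b c d a' b' c' d' : k} :
    T.comb a b c d = T.comb a' b' c' d' ↔ a = a' ∧ b = b' ∧ c = c' ∧ d = d' := by
  refine ⟨fun h => ?_, by rintro ⟨rfl, rfl, rfl, rfl⟩; rfl⟩
  have h0 := congrArg T.dx h
  have h1 := congrArg T.dy h
  have h01 := congrArg T.dy h0
  simp only [dx_comb, dy_comb] at h0 h1 h01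
  exact ⟨by simpa [aug_comb] using congrArg T.aug h, by simpa [aug_comb] using congrArg T.aug h0,
    by simpa [aug_comb] using congrArg T.aug h1, by simpa [aug_comb] using congrArg T.aug h01⟩

/-- The coordinates with respect to `1, x, y, x y`. -/
noncomputable def coords : (Fin 4 → k) ≃ₗ[k] A :=
  LinearEquiv.ofBijective
    { toFun := fun v => T.comb (v 0) (v 1) (v 2) (v 3)
      map_add' := fun v w => by simp [comb_add]
      map_smul' := fun r v => by simp [smul_comb] }
    ⟨fun v w h => by
      have h := T.comb_inj.1 h
      funext i
      fin_cases i <;> simp [h],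
    fun f => by
      obtain ⟨a, b, c, d, rfl⟩ := T.exists_comb f
      exact ⟨![a, b, c, d], rfl⟩⟩

theorem coords_apply (v : Fin 4 → k) : T.coords v = T.comb (v 0) (v 1) (v 2) (v 3) := rfl

theorem coords_symm_comb (a b c d : k) : T.coords.symm (T.comb a b c d) = ![a, b, c, d] := by
  rw [LinearEquiv.symm_apply_eq]; rfl

/-- The basis `1, x, y, x y`. -/
noncomputable def basis : Module.Basis (Fin 4) k A := Module.Basis.ofEquivFun T.coords.symm

theorem basis_apply : T.basis 0 = T.comb 1 0 0 0 ∧ T.basis 1 = T.comb 0 1 0 0 ∧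
    T.basis 2 = T.comb 0 0 1 0 ∧ T.basis 3 = T.comb 0 0 0 1 := by
  refine ⟨?_, ?_, ?_, ?_⟩ <;> simp [basis, coords_apply]

theorem end_ext {B C : Module.End k A} (h0 : B 1 = C 1) (h1 : B T.x = C T.x) (h2 : B T.y = C T.y)
    (h3 : B (T.x * T.y) = C (T.x * T.y)) : B = C := by
  refine LinearMap.ext fun f => ?_
  obtain ⟨a, b, c, d, rfl⟩ := T.exists_eq f
  simp only [map_add, map_smul, h0, h1, h2, h3]

theorem trace_eq (B : Module.End k A) : LinearMap.trace k _ B =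
    T.coords.symm (B 1) 0 + T.coords.symm (B T.x) 1 +
      T.coords.symm (B T.y) 2 + T.coords.symm (B (T.x * T.y)) 3 := by
  rw [LinearMap.trace_eq_matrix_trace k T.basis]
  have h3 : T.x * T.y = T.comb 0 0 0 1 := by simp [comb]
  rw [h3, x_eq, y_eq, one_eq T]
  simp [Matrix.trace, Fin.sum_univ_four, LinearMap.toMatrix_apply, T.basis_apply.1,
    T.basis_apply.2.1, T.basis_apply.2.2.1, T.basis_apply.2.2.2]
  rfl

theorem dx_dy (f : A) : T.dx (T.dy f) = T.dy (T.dx f) := by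
  obtain ⟨a, b, c, d, rfl⟩ := T.exists_comb f
  simp only [dy_comb, dx_comb]

theorem derivation_eq (D : Derivation k A A) : D = D T.x • T.dx + D T.y • T.dy := by
  ext f
  obtain ⟨a, b, c, d, rfl⟩ := T.exists_eq f
  simp [T.dx_x, T.dx_y, T.dy_x, T.dy_y, Algebra.smul_def]
  ring

theorem lie_smul {D E : Derivation k A A} (h : ∀ f, D (E f) = E (D f)) (p q : A) :
    ⁅p • D, q • E⁆ = (p * D q) • E - (q * E p) • D := by
  ext f
  simp [Derivation.commutator_apply, h]
  ring

/-- Derivations are determined by their values at the generators. -/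
noncomputable def derivationEquiv : Derivation k A A ≃ₗ[k] A × A where
  toFun D := (D T.x, D T.y)
  map_add' _ _ := rfl
  map_smul' _ _ := rfl
  invFun p := p.1 • T.dx + p.2 • T.dy
  left_inv D := (T.derivation_eq D).symm
  right_inv p := by simp [T.dx_x, T.dx_y, T.dy_x, T.dy_y]

theorem finrank_eq (T : TruncData k A) : Module.finrank k A = 4 := by
  rw [← T.coords.finrank_eq]; simp

theorem finrank_quotient (T : TruncData k A) : Module.finrank k (DerSemidirect k A ⧸ scalarIdeal k A) = 11 := by
  have : Module.Finite k A := Module.Finite.equiv T.coords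
  let e : DerSemidirect k A ≃ₗ[k] A × (A × A) :=
    (LieAlgebra.SemiDirectSum.toProdl _).trans
      ((LinearEquiv.refl k _).prodCongr T.derivationEquiv)
  have : Module.Finite k (DerSemidirect k A) := Module.Finite.equiv e.symm
  have h1 : Module.finrank k (DerSemidirect k A) = 12 := by
    rw [e.finrank_eq, Module.finrank_prod, Module.finrank_prod, T.finrank_eq]
  let u : DerSemidirect k A := ⟨1, 0⟩
  have hu : u ≠ 0 := fun h => by
    have := congrArg (fun w : DerSemidirect k A => T.aug w.left) h
    simp [u] at this
  have h2 : (scalarIdeal k A).toSubmodule = k ∙ u := by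
    ext w
    rw [Submodule.mem_span_singleton]
    constructor
    · rintro ⟨h, c, hc⟩
      exact ⟨c, LieAlgebra.SemiDirectSum.ext hc.symm (by rw [h]; simp [u])⟩
    · rintro ⟨c, rfl⟩
      exact ⟨by simp [u], c, rfl⟩
  have h3 := Submodule.finrank_quotient_add_finrank (scalarIdeal k A).toSubmodule
  rw [h1, h2, finrank_span_singleton hu, ← h2] at h3
  exact Nat.succ_injective h3

/-- `Der(A) ⋉ A` is perfect. -/
theorem eq_top_of_lie_mem (T : TruncData k A) (S : Submodule k (DerSemidirect k A))
    (h : ∀ v w : DerSemidirect k A, ⁅v, w⁆ ∈ S) : S = ⊤ := by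
  have hl : ∀ (D : Derivation k A A) (f : A), (⟨D f, 0⟩ : DerSemidirect k A) ∈ S := by
    intro D f
    have := h ⟨0, D⟩ ⟨f, 0⟩
    rw [LieAlgebra.SemiDirectSum.lie_eq_mk] at this
    simpa [show derAction k A D f = D f from rfl] using this
  have hr : ∀ D E : Derivation k A A, (⟨0, ⁅D, E⁆⟩ : DerSemidirect k A) ∈ S := by
    intro D E
    have := h ⟨0, D⟩ ⟨0, E⟩
    rw [LieAlgebra.SemiDirectSum.lie_eq_mk] at this
    simpa using this
  have h1 : ∀ f, (⟨f, 0⟩ : DerSemidirect k A) ∈ S := by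
    intro f
    obtain ⟨a, b, c, d, rfl⟩ := T.exists_eq f
    have e1 := hl T.dx T.x
    have e2 := hl (T.x • T.dx) T.x
    have e3 := hl (T.y • T.dx) T.x
    have e4 := hl ((T.x * T.y) • T.dx) T.x
    simp only [Derivation.smul_apply, T.dx_x, smul_eq_mul, mul_one] at e1 e2 e3 e4
    have := add_mem (add_mem (add_mem (S.smul_mem a e1) (S.smul_mem b e2)) (S.smul_mem c e3))
      (S.smul_mem d e4)
    simpa using this
  -- If `E` commutes with `∂x` and `∂y`, then `E = [∂x, x E]`, `x E = [∂y, xy E]` and `y E = [∂x, xy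
  -- E]`. The top term `xy E` needs a separate bracket, such as `[y ∂y, xy ∂x] = xy ∂x`.
  have key : ∀ E : Derivation k A A, (∀ f, T.dx (E f) = E (T.dx f)) →
      (∀ f, T.dy (E f) = E (T.dy f)) → (⟨0, (T.x * T.y) • E⟩ : DerSemidirect k A) ∈ S →
      ∀ f : A, (⟨0, f • E⟩ : DerSemidirect k A) ∈ S := by
    intro E hx hy hxy f
    obtain ⟨a, b, c, d, rfl⟩ := T.exists_eq f
    have e1 := hr ((1 : A) • T.dx) (T.x • E)
    have e2 := hr ((1 : A) • T.dy) ((T.x * T.y) • E)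
    have e3 := hr ((1 : A) • T.dx) ((T.x * T.y) • E)
    rw [lie_smul hx] at e1 e3
    rw [lie_smul hy] at e2
    simp [T.dx_x, T.dx_y, T.dy_x, T.dy_y] at e1 e2 e3
    have := add_mem (add_mem (add_mem (S.smul_mem a e1) (S.smul_mem b e2)) (S.smul_mem c e3))
      (S.smul_mem d hxy)
    simpa [add_smul, smul_assoc] using this
  have h2 : ∀ f : A, (⟨0, f • T.dx⟩ : DerSemidirect k A) ∈ S := by
    refine key T.dx (fun _ => rfl) (fun f => (T.dx_dy f).symm) ?_
    have := hr (T.y • T.dy) ((T.x * T.y) • T.dx)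
    rw [lie_smul fun f => (T.dx_dy f).symm] at this
    simpa [T.dx_x, T.dx_y, T.dy_x, T.dy_y, mul_comm] using this
  have h3 : ∀ f : A, (⟨0, f • T.dy⟩ : DerSemidirect k A) ∈ S := by
    refine key T.dy T.dx_dy (fun _ => rfl) ?_
    have := hr (T.x • T.dx) ((T.x * T.y) • T.dy)
    rw [lie_smul T.dx_dy] at this
    simpa [T.dx_x, T.dx_y, T.dy_x, T.dy_y, mul_comm] using this
  rw [eq_top_iff]
  rintro ⟨f, D⟩ -
  rw [T.derivation_eq D]
  have := add_mem (h1 f) (add_mem (h2 (D T.x)) (h3 (D T.y)))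
  simpa using this

/-- The symbol of order two of a linear operator. -/
def symbol : Module.End k A →ₗ[k] A where
  toFun B := B (T.x * T.y) - T.x * B T.y - T.y * B T.x + T.x * T.y * B 1
  map_add' B C := by simp; ring
  map_smul' c B := by simp [Algebra.smul_def]; ring

theorem symbol_apply (B : Module.End k A) :
    T.symbol B = B (T.x * T.y) - T.x * B T.y - T.y * B T.x + T.x * T.y * B 1 := rfl

theorem derRep_apply (w : DerSemidirect k A) (f : A) : derRep k A w f = w.right f + w.left * f := rfl

/-- An operator of order at most one is recovered from `B 1`, `B x`, `B y`; the vanishing symbol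
says precisely that its value at `xy` is then the expected one. -/
theorem symbol_eq_zero_iff {B : Module.End k A} :
    T.symbol B = 0 ↔ ∃ w : DerSemidirect k A, derRep k A w = B := by
  constructor
  · intro h
    rw [symbol_apply] at h
    refine ⟨⟨B 1, (B T.x - T.x * B 1) • T.dx + (B T.y - T.y * B 1) • T.dy⟩, T.end_ext ?_ ?_ ?_ ?_⟩
    · simp [derRep_apply]
    · simp [derRep_apply, T.dx_x, T.dx_y, T.dy_x, T.dy_y]; ring
    · simp [derRep_apply, T.dx_x, T.dx_y, T.dy_x, T.dy_y]; ring
    · simp [derRep_apply, T.dx_x, T.dx_y, T.dy_x, T.dy_y]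
      linear_combination -h
  · rintro ⟨w, rfl⟩
    simp [symbol_apply, derRep_apply]
    ring

/-- In characteristic two the four terms of the symbol contribute to the coefficient of `xy` the
four diagonal entries of `B`. Hence the traceless operators modulo those of order at most one form a
space of dimension three. -/
theorem trace_eq_symbol [CharP k 2] (B : Module.End k A) :
    LinearMap.trace k _ B = T.coords.symm (T.symbol B) 3 := by
  have h2 : (2 : k) = 0 := CharTwo.two_eq_zero
  rw [trace_eq, symbol_apply]
  obtain ⟨a, b, c, d, h0⟩ := T.exists_comb (B 1)
  obtain ⟨a', b', c', d', h1⟩ := T.exists_comb (B T.x)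
  obtain ⟨a'', b'', c'', d'', h3⟩ := T.exists_comb (B T.y)
  rw [h0, h1, h3, sub_eq_add_neg, sub_eq_add_neg, ← neg_one_smul k, ← neg_one_smul k (T.y * _),
    CharTwo.neg_eq, one_smul, one_smul, T.x_eq, T.y_eq]
  simp only [comb_mul, map_add, Pi.add_apply, coords_symm_comb]
  simp
  ring

theorem derRep_mem_slEnd (T : TruncData k A) [CharP k 2] (w : DerSemidirect k A) : derRep k A w ∈ slEnd k A := by
  change LinearMap.trace k A _ = 0
  rw [T.trace_eq_symbol, T.symbol_eq_zero_iff.2 ⟨w, rfl⟩]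
  simp

end TruncData

/-! ### Maximality: generating all of `sl(A)` from one second-order operator. -/

namespace TruncData

variable {k A : Type*} [Field k] [CommRing A] [Algebra k A] (T : TruncData k A)

/-- The operator `f ∂x ∂y`. -/
def opTwo (f : A) : Module.End k A := LinearMap.mulLeft k f * ((T.dx : A →ₗ[k] A) * (T.dy : A →ₗ[k] A))

theorem opTwo_apply (f g : A) : T.opTwo f g = f * T.dx (T.dy g) := rfl

theorem symbol_opTwo (f : A) : T.symbol (T.opTwo f) = f := by
  simp [symbol_apply, opTwo_apply, T.dx_x, T.dx_y, T.dy_x, T.dy_y]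

theorem mem_slEnd_iff [CharP k 2] {B : Module.End k A} :
    B ∈ slEnd k A ↔ T.coords.symm (T.symbol B) 3 = 0 := by
  rw [← T.trace_eq_symbol]; rfl

/-- As `N` contains the kernel of the symbol, it is determined by its space `S` of symbols, and any
`f ∈ S` may be represented by `f ∂x ∂y`. It suffices to show that `1, x, y ∈ S`. -/
theorem eq_top_of_symbol_ne_zero [CharP k 2] (N : LieSubalgebra k (slEnd k A))
    (hN : ∀ B : slEnd k A, T.symbol B = 0 → B ∈ N) {u : slEnd k A} (hu : u ∈ N)
    (hu0 : T.symbol u ≠ 0) : N = ⊤ := by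
  let s : slEnd k A →ₗ[k] A := T.symbol ∘ₗ (slEnd k A).toSubmodule.subtype
  let S : Submodule k A := N.toSubmodule.map s
  have hS : ∀ B : slEnd k A, s B ∈ S → B ∈ N := by
    rintro B ⟨C, hC, h⟩
    have : B - C ∈ N := hN _ (by
      have : s (B - C) = 0 := by rw [map_sub, h, sub_self]
      exact this)
    simpa using add_mem this hC
  have hD : ∀ w : DerSemidirect k A, ∀ f ∈ S, T.coords.symm f 3 = 0 →
      T.symbol (derRep k A w * T.opTwo f - T.opTwo f * derRep k A w) ∈ S := by
    intro w f hf hf3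
    let C : slEnd k A := ⟨T.opTwo f, T.mem_slEnd_iff.2 (by rwa [symbol_opTwo])⟩
    have hC : C ∈ N := hS C (by
      have : s C = f := T.symbol_opTwo f
      rwa [this])
    have hw : (⟨derRep k A w, T.derRep_mem_slEnd w⟩ : slEnd k A) ∈ N :=
      hN _ (T.symbol_eq_zero_iff.2 ⟨w, rfl⟩)
    exact ⟨_, N.lie_mem hw hC, rfl⟩
  have hx : ∀ f ∈ S, T.coords.symm f 3 = 0 → T.dx f ∈ S := by
    intro f hf hf3
    have := hD ⟨0, T.dx⟩ f hf hf3
    convert this using 1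
    simp [symbol_apply, opTwo_apply, derRep_apply, T.dx_x, T.dx_y, T.dy_x, T.dy_y]
  have hy : ∀ f ∈ S, T.coords.symm f 3 = 0 → T.dy f ∈ S := by
    intro f hf hf3
    have := hD ⟨0, T.dy⟩ f hf hf3
    convert this using 1
    simp [symbol_apply, opTwo_apply, derRep_apply, T.dx_x, T.dx_y, T.dy_x, T.dy_y]
  have h13 : T.coords.symm 1 3 = 0 := by rw [one_eq T, coords_symm_comb]; rfl
  have h1 : (1 : A) ∈ S := by
    have hS0 : T.symbol u ∈ S := ⟨u, hu, rfl⟩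
    have h3 := T.mem_slEnd_iff.1 u.2
    obtain ⟨a, b, c, d, hf⟩ := T.exists_comb (T.symbol u)
    have hx := hx _ hS0 h3
    have hy := hy _ hS0 h3
    rw [hf] at hS0 hu0 h3 hx hy
    rw [coords_symm_comb] at h3
    obtain rfl : d = 0 := h3
    rw [dx_comb] at hx
    rw [dy_comb] at hy
    have key : ∀ r : k, r ≠ 0 → T.comb r 0 0 0 ∈ S → (1 : A) ∈ S := by
      intro r hr h
      have := S.smul_mem r⁻¹ h
      rw [smul_comb, inv_mul_cancel₀ hr, mul_zero] at this
      rwa [one_eq T]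
    by_cases hb : b = 0
    · by_cases hc : c = 0
      · subst hb hc
        refine key a (fun ha => hu0 ?_) hS0
        rw [ha, ← zero_eq T]
      · exact key c hc hy
    · exact key b hb hx
  -- The bracket of `xy ∂x` with `∂x ∂y` has symbol `± y`, because `∂x² = 0` on `A`.
  have h2 : T.y ∈ S := by
    have := hD ⟨0, (T.x * T.y) • T.dx⟩ 1 h1 h13
    simpa [symbol_apply, opTwo_apply, derRep_apply, T.dx_x, T.dx_y, T.dy_x, T.dy_y] using this
  have h3 : T.x ∈ S := by
    have := hD ⟨0, (T.x * T.y) • T.dy⟩ 1 h1 h13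
    simpa [symbol_apply, opTwo_apply, derRep_apply, T.dx_x, T.dx_y, T.dy_x, T.dy_y] using this
  rw [eq_top_iff]
  intro B _
  refine hS B ?_
  have hB := T.mem_slEnd_iff.1 B.2
  change T.symbol B ∈ S
  obtain ⟨a, b, c, d, hf⟩ := T.exists_comb (T.symbol B)
  rw [hf, coords_symm_comb] at hB
  obtain rfl : d = 0 := hB
  rw [hf, comb, zero_smul, add_zero]
  exact add_mem (add_mem (S.smul_mem _ h1) (S.smul_mem _ h3)) (S.smul_mem _ h2)

theorem derRep_eq_smul_one_iff {w : DerSemidirect k A} :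
    (∃ c : k, derRep k A w = c • 1) ↔ w ∈ scalarIdeal k A := by
  constructor
  · rintro ⟨c, hc⟩
    have h : ∀ f, w.right f + w.left * f = c • f := fun f => by
      rw [← derRep_apply, hc]; rfl
    have h1 : w.left = c • 1 := by simpa using h 1
    refine ⟨?_, c, h1⟩
    ext f
    have := h f
    rw [h1] at this
    simpa using this
  · rintro ⟨h, c, hc⟩
    refine ⟨c, LinearMap.ext fun f => ?_⟩
    rw [derRep_apply, h, hc]
    simp

end TruncData

/-! ### Triviality of representations of dimension at most two. -/

namespace TruncData

variable {k A : Type*} [Field k] [CommRing A] [Algebra k A] (T : TruncData k A)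

theorem exists_smul_one_of_trace_eq_zero [CharP k 2] {n : ℕ} (hn : n ≤ 2)
    {M N : Matrix (Fin n) (Fin n) k} (hM : M.trace = 0) (hN : N.trace = 0) :
    ∃ c : k, M * N - N * M = c • 1 := by
  have h2 : (2 : k) = 0 := CharTwo.two_eq_zero
  interval_cases n
  · exact ⟨0, Subsingleton.elim _ _⟩
  · refine ⟨0, ?_⟩
    ext i j
    fin_cases i; fin_cases j
    simp [Matrix.mul_apply, mul_comm]
  · refine ⟨M 0 1 * N 1 0 - N 0 1 * M 1 0, ?_⟩
    simp only [Matrix.trace, Matrix.diag, Fin.sum_univ_two] at hM hN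
    ext i j
    fin_cases i <;> fin_cases j <;> simp [Matrix.mul_apply, Fin.sum_univ_two] <;> grind

/-- `Der(A) ⋉ A` acts trivially in dimension at most two (in characteristic two). -/
theorem eq_zero_of_finrank_le_two (T : TruncData k A) [CharP k 2] {Q : Type*} [AddCommGroup Q] [Module k Q]
    [FiniteDimensional k Q] (hQ : Module.finrank k Q ≤ 2)
    (f : DerSemidirect k A →ₗ[k] Module.End k Q)
    (hf : ∀ v w, f ⁅v, w⁆ = f v * f w - f w * f v) : f = 0 := by
  -- Perfectness is used three times: the image is traceless, then scalar (in characteristic two,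
  -- commutators of traceless `2 × 2` matrices are scalar), then zero.
  have h1 := T.eq_top_of_lie_mem (LinearMap.ker (LinearMap.trace k Q ∘ₗ f)) fun v w => by
    rw [LinearMap.mem_ker, LinearMap.comp_apply, hf, map_sub, LinearMap.trace_mul_comm, sub_self]
  have h1' : ∀ w, LinearMap.trace k Q (f w) = 0 := fun w => by
    have : w ∈ LinearMap.ker (LinearMap.trace k Q ∘ₗ f) := h1 ▸ Submodule.mem_top
    exact this
  have h2 := T.eq_top_of_lie_mem ((k ∙ (1 : Module.End k Q)).comap f) fun v w => by
    rw [Submodule.mem_comap, hf, Submodule.mem_span_singleton]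
    let b := Module.finBasis k Q
    have ht : ∀ w, (LinearMap.toMatrixAlgEquiv b (f w)).trace = 0 := fun w =>
      (LinearMap.trace_eq_matrix_trace k b (f w)).symm.trans (h1' w)
    obtain ⟨c, hc⟩ := exists_smul_one_of_trace_eq_zero hQ (ht v) (ht w)
    refine ⟨c, (LinearMap.toMatrixAlgEquiv b).injective ?_⟩
    rw [map_smul, map_one, map_sub, map_mul, map_mul, hc]
  have h3 := T.eq_top_of_lie_mem (LinearMap.ker f) fun v w => by
    have hv : v ∈ (k ∙ (1 : Module.End k Q)).comap f := h2 ▸ Submodule.mem_top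
    have hw : w ∈ (k ∙ (1 : Module.End k Q)).comap f := h2 ▸ Submodule.mem_top
    obtain ⟨c, hc⟩ := Submodule.mem_span_singleton.1 hv
    obtain ⟨d, hd⟩ := Submodule.mem_span_singleton.1 hw
    rw [LinearMap.mem_ker, hf, ← hc, ← hd]
    simp [mul_comm, smul_smul]
  exact LinearMap.ker_eq_top.1 h3

end TruncData

/-! ### Spaces of octonions with zero multiplication. -/

namespace SplitOct

open LinAlgGroup

variable {k : Type*} [Field k] [CharP k 2]

omit [CharP k 2] in
theorem exists_polar_eq {u : Fin 3 → SplitOct k} (hu : LinearIndependent k u) (i : Fin 3) :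
    ∃ a, ∀ j, polar (u j) a = if j = i then 1 else 0 := by
  obtain ⟨f, hf⟩ := LinearMap.exists_extend (Finsupp.lapply i ∘ₗ hu.repr)
  refine ⟨(LinearMap.BilinForm.toDual polar polar_nondegenerate).symm f, fun j => ?_⟩
  rw [polar_comm, LinearMap.BilinForm.apply_toDual_symm_apply]
  have h := LinearMap.congr_fun hf ⟨u j, Submodule.subset_span ⟨j, rfl⟩⟩
  simp only [LinearMap.comp_apply, Submodule.subtype_apply] at h
  rw [h, hu.repr_eq_single j ⟨u j, Submodule.subset_span ⟨j, rfl⟩⟩ rfl]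
  simp [Finsupp.single_apply]

/-- There is no three-dimensional space of traceless octonions with zero multiplication. -/
theorem not_linearIndependent_of_mul_eq_zero {u : Fin 3 → SplitOct k} (htr : ∀ i, tr (u i) = 0)
    (hmul : ∀ i j, mul (u i) (u j) = 0) : ¬ LinearIndependent k u := by
  intro hu
  have hn : ∀ i, nrm (u i) = 0 := by
    intro i
    have := mul_self (u i)
    rw [hmul, htr, zero_smul, zero_add, eq_comm, smul_eq_zero, or_iff_left one_ne_zero] at this
    exact this
  obtain ⟨a, ha⟩ := exists_polar_eq hu 0
  obtain ⟨d, hd⟩ := exists_polar_eq hu 1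
  -- An idempotent: trace 1 and norm 0. The vectors `u 1` and `u 2` lie in the Peirce space where `e
  -- u = 0` and `u e = u`.
  obtain ⟨e, he⟩ : ∃ e, e = mul (u 0) a := ⟨_, rfl⟩
  have hp : ∀ x : SplitOct k, polar 0 x = 0 := fun x => by rw [map_zero, LinearMap.zero_apply]
  have hz : ∀ x : SplitOct k, mul 0 x = 0 := fun x => by
    rw [← mulₗ_apply, map_zero, LinearMap.zero_apply]
  have hz' : ∀ x : SplitOct k, mul x 0 = 0 := fun x => by rw [← mulₗ_apply, map_zero]
  have he1 : tr e = 1 := by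
    rw [he, tr_mul, ha, htr, if_pos rfl, zero_mul, add_zero]
  have he2 : nrm e = 0 := by rw [he, nrm_mul, hn, zero_mul]
  have hey : ∀ j, j ≠ 0 → mul e (u j) = 0 := by
    intro j hj
    have := mul_mul_add_right (u 0) a (u j) (htr j)
    rw [hmul, hz, polar_comm, ha, if_neg hj, zero_smul, smul_zero, add_zero, add_zero] at this
    rw [he, this]
  have hye : ∀ j, j ≠ 0 → mul (u j) e = u j := by
    intro j hj
    have h1 := mul_add_mul_comm (u j) e
    have h2 : polar (u j) e = 0 := by
      rw [he, polar_mul_left, hmul, htr, hp, zero_mul, add_zero]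
    rw [hey j hj, htr, he1, h2, zero_smul, zero_smul, one_smul, zero_add, add_zero, add_zero] at h1
    exact h1
  -- Since `u 2 = (u 2) e`, the middle Moufang identity turns the product into `(e (d (u 2))) e`, a
  -- multiple of `e`.
  have h1 : mul (mul e d) (u 2) = (polar e (mul d (u 2)) + tr e * tr (mul d (u 2))) • e := by
    rw [← mul_mul_self_right _ _ he2, ← moufang_middle, hye 2 (by decide)]
  -- The linearised left alternative law becomes `u 2 = (u 1) (c e) = c (u 1)`, against linear
  -- independence.
  have h2 := mul_mul_add_left (u 1) (mul e d) (u 2) (htr 1)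
  have h3 : polar (u 1) (mul e d) = 1 := by
    rw [polar_mul_left, hey 1 (by decide), he1, hd, if_pos rfl, hp, zero_add, _root_.one_mul]
  generalize polar e (mul d (u 2)) + tr e * tr (mul d (u 2)) = c at h1
  rw [h3, h1, hmul, hz', ← mulₗ_apply, map_smul, mulₗ_apply, hye 1 (by decide), smul_zero, add_zero,
    add_zero, one_smul] at h2
  obtain ⟨b, hb⟩ := exists_polar_eq hu 2
  have h4 := hb 2
  rw [if_pos rfl, ← h2, map_smul, LinearMap.smul_apply, hb, if_neg (by decide), smul_zero] at h4
  exact zero_ne_one h4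

end SplitOct

/-! ### Stable subspaces of the traceless octonions. -/

open SplitOct LinAlgGroup

/-- A representation of `Der(A) ⋉ A` by derivations of the split octonions, with image of
codimension at most three, such that the operators from `A` have square zero and act nontrivially on
the traceless octonions modulo scalars. -/
structure IsOctonionRep {k A : Type*} [Field k] [CharP k 2] [CommRing A] [Algebra k A]
    (σ : DerSemidirect k A →ₗ⁅k⁆ Module.End k (SplitOct k)) : Prop where
  exists_pslAct : ∀ w, ∃ M : Matrix (Fin 4) (Fin 4) k, M.trace = 0 ∧ pslAct M = σ w
  exists_eq : ∀ m : (Fin 4 → k) →ₗ[k] Matrix (Fin 4) (Fin 4) k, (∀ c, (m c).trace = 0) →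
    ∃ c, c ≠ 0 ∧ ∃ w, σ w = pslAct (m c)
  mul_self : ∀ (f : A) (x : SplitOct k), σ ⟨f, 0⟩ (σ ⟨f, 0⟩ x) = 0
  exists_notMem : ∃ (f : A) (x : SplitOct k), tr x = 0 ∧ σ ⟨f, 0⟩ x ∉ k ∙ (one : SplitOct k)

namespace IsOctonionRep

variable {k A : Type*} [Field k] [CharP k 2] [CommRing A] [Algebra k A] (T : TruncData k A)
  {σ : DerSemidirect k A →ₗ⁅k⁆ Module.End k (SplitOct k)} (h : IsOctonionRep σ)

/-- A stable subspace of the traceless octonions which properly contains the scalars. -/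
structure IsStable (σ : DerSemidirect k A →ₗ⁅k⁆ Module.End k (SplitOct k))
    (U : Submodule k (SplitOct k)) : Prop where
  apply_mem : ∀ w, ∀ u ∈ U, σ w u ∈ U
  one_mem : one ∈ U
  le_ker : U ≤ LinearMap.ker tr
  ne : U ≠ k ∙ one

omit [CharP k 2] in
theorem IsStable.exists_notMem {U : Submodule k (SplitOct k)} (hU : IsStable σ U) :
    ∃ x ∈ U, x ∉ k ∙ (one : SplitOct k) := by
  by_contra! hx
  exact hU.ne (le_antisymm hx (by simpa using hU.one_mem))

include h in
theorem apply_one (w : DerSemidirect k A) : σ w one = 0 := by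
  obtain ⟨M, -, hM⟩ := h.exists_pslAct w
  rw [← hM, pslAct_one]

include h in
theorem apply_scalar (w : DerSemidirect k A) {x : SplitOct k} (hx : x ∈ k ∙ (one : SplitOct k)) :
    σ w x = 0 := by
  obtain ⟨c, rfl⟩ := Submodule.mem_span_singleton.1 hx
  rw [map_smul, h.apply_one, smul_zero]

include h in
theorem tr_apply (w : DerSemidirect k A) (x : SplitOct k) : tr (σ w x) = 0 := by
  obtain ⟨M, -, hM⟩ := h.exists_pslAct w
  rw [← hM, tr_pslAct]

include h in
theorem polar_apply (w : DerSemidirect k A) (x y : SplitOct k) :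
    polar (σ w x) y = polar x (σ w y) := by
  obtain ⟨M, -, hM⟩ := h.exists_pslAct w
  rw [← hM, polar_pslAct]

-- If the dimension were at most three, `U / k1` would have dimension at most two and a trivial
-- action. Then the whole image would fix some traceless octonion modulo scalars, but it meets every
-- four-dimensional complement to such a stabilizer.
include h T in
theorem four_le_finrank {U : Submodule k (SplitOct k)} (hU : IsStable σ U) :
    4 ≤ Module.finrank k U := by
  by_contra! hlt
  let K : Submodule k U := (k ∙ (one : SplitOct k)).comap U.subtype
  have hK : ∀ w, K ≤ K.comap ((σ w).restrict (hU.apply_mem w)) := by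
    intro w x hx
    have : σ w x.1 = 0 := h.apply_scalar w hx
    change σ w x.1 ∈ k ∙ (one : SplitOct k)
    rw [this]
    exact zero_mem _
  have hKr : Module.finrank k K = 1 := by
    have e : K = k ∙ (⟨one, hU.one_mem⟩ : U) := by
      ext x
      rw [Submodule.mem_comap, Submodule.mem_span_singleton, Submodule.mem_span_singleton]
      exact exists_congr fun c => (Subtype.ext_iff (a1 := c • (⟨one, hU.one_mem⟩ : U))).symm
    rw [e]
    exact finrank_span_singleton fun h0 => one_ne_zero (Subtype.ext_iff.1 h0)
  have hQ : Module.finrank k (U ⧸ K) ≤ 2 := by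
    have := Submodule.finrank_quotient_add_finrank K
    omega
  let f : DerSemidirect k A →ₗ[k] Module.End k (U ⧸ K) :=
    { toFun := fun w => K.mapQ K ((σ w).restrict (hU.apply_mem w)) (hK w)
      map_add' := fun v w => by
        refine LinearMap.ext fun x => ?_
        induction x using Submodule.Quotient.induction_on with | _ x
        rw [LinearMap.add_apply, Submodule.mapQ_apply, Submodule.mapQ_apply, Submodule.mapQ_apply,
          ← Submodule.Quotient.mk_add]
        congr 1
        exact Subtype.ext (by
          change σ (v + w) x.1 = σ v x.1 + σ w x.1
          rw [map_add, LinearMap.add_apply])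
      map_smul' := fun c v => by
        refine LinearMap.ext fun x => ?_
        induction x using Submodule.Quotient.induction_on with | _ x
        rw [LinearMap.smul_apply, Submodule.mapQ_apply, Submodule.mapQ_apply,
          ← Submodule.Quotient.mk_smul]
        congr 1
        exact Subtype.ext (by
          change σ (c • v) x.1 = c • σ v x.1
          rw [map_smul, LinearMap.smul_apply]) }
  have hf := T.eq_zero_of_finrank_le_two hQ f fun v w => by
    refine LinearMap.ext fun x => ?_
    induction x using Submodule.Quotient.induction_on with | _ x
    rw [LinearMap.sub_apply, Module.End.mul_apply, Module.End.mul_apply]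
    simp only [f, LinearMap.coe_mk, AddHom.coe_mk]
    rw [Submodule.mapQ_apply, Submodule.mapQ_apply, Submodule.mapQ_apply, Submodule.mapQ_apply,
      Submodule.mapQ_apply, ← Submodule.Quotient.mk_sub]
    congr 1
    exact Subtype.ext (by
      change σ ⁅v, w⁆ x.1 = σ v (σ w x.1) - σ w (σ v x.1)
      rw [LieHom.map_lie, Ring.lie_def]
      rfl)
  obtain ⟨x, hxU, hx⟩ := hU.exists_notMem
  have hfx : ∀ w, σ w x ∈ k ∙ (one : SplitOct k) := by
    intro w
    have := LinearMap.congr_fun (LinearMap.congr_fun hf w) (K.mkQ ⟨x, hxU⟩)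
    exact (Submodule.Quotient.mk_eq_zero K).1 this
  obtain ⟨m, hm, hm0⟩ := exists_four_dim_complement (hU.le_ker hxU) fun c hc =>
    hx (Submodule.mem_span_singleton.2 ⟨c, hc.symm⟩)
  obtain ⟨c, hc, w, hw⟩ := h.exists_eq m hm
  obtain ⟨d, hd⟩ := Submodule.mem_span_singleton.1 (hfx w)
  exact hc (hm0 c d (by rw [← hw, hd]))

/-- The traceless octonions killed by `A` modulo scalars. -/
def kerA (σ : DerSemidirect k A →ₗ⁅k⁆ Module.End k (SplitOct k)) : Submodule k (SplitOct k) where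
  carrier := {x | tr x = 0 ∧ ∀ f : A, σ ⟨f, 0⟩ x ∈ k ∙ (one : SplitOct k)}
  zero_mem' := ⟨map_zero _, fun f => by rw [map_zero]; exact zero_mem _⟩
  add_mem' hx hy := ⟨by rw [map_add, hx.1, hy.1, add_zero], fun f => by
    rw [map_add]; exact add_mem (hx.2 f) (hy.2 f)⟩
  smul_mem' c x hx := ⟨by rw [map_smul, hx.1, smul_zero], fun f => by
    rw [map_smul]; exact Submodule.smul_mem _ _ (hx.2 f)⟩

omit [CharP k 2] in
theorem apply_lie (v w : DerSemidirect k A) (x : SplitOct k) :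
    σ v (σ w x) = σ w (σ v x) + σ ⁅v, w⁆ x := by
  rw [LieHom.map_lie, Ring.lie_def, LinearMap.sub_apply, Module.End.mul_apply, Module.End.mul_apply]
  abel

omit [CharP k 2] in
theorem apply_comm (f g : A) (x : SplitOct k) : σ ⟨f, 0⟩ (σ ⟨g, 0⟩ x) = σ ⟨g, 0⟩ (σ ⟨f, 0⟩ x) := by
  have : ⁅(⟨f, 0⟩ : DerSemidirect k A), (⟨g, 0⟩ : DerSemidirect k A)⁆ = 0 := by
    rw [LieAlgebra.SemiDirectSum.lie_eq_mk]
    simp [Ring.lie_def, mul_comm]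
  rw [apply_lie, this, map_zero, LinearMap.zero_apply, add_zero]

include h in
theorem apply_mem_kerA (w : DerSemidirect k A) {x : SplitOct k} (hx : x ∈ kerA σ) :
    σ w x ∈ kerA σ := by
  refine ⟨h.tr_apply w x, fun f => ?_⟩
  have : ⁅(⟨f, 0⟩ : DerSemidirect k A), w⁆ = ⟨-(derAction k A w.right f), 0⟩ := by
    rw [LieAlgebra.SemiDirectSum.lie_eq_mk]
    simp [Ring.lie_def, mul_comm]
  rw [apply_lie, this, h.apply_scalar w (hx.2 f), zero_add]
  exact hx.2 _

include h T in
/-- Nilpotency: `A` has a common null vector modulo scalars in every stable subspace. -/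
theorem inf_kerA {U : Submodule k (SplitOct k)} (hU : IsStable σ U) : IsStable σ (U ⊓ kerA σ) := by
  refine ⟨fun w u hu => ⟨hU.apply_mem w u hu.1, h.apply_mem_kerA w hu.2⟩,
    ⟨hU.one_mem, tr_one, fun f => by rw [h.apply_one]; exact zero_mem _⟩,
    inf_le_left.trans hU.le_ker, fun he => ?_⟩
  -- `P g`: a vector killed modulo scalars by the operators in `s` can be replaced by one also
  -- killed by `g`, namely itself or its image under `g`. This uses that the operators commute and
  -- have square zero; applying it to `1, x, y, xy` handles all of `A`.
  let P : A → Prop := fun g => ∀ x ∈ U, x ∉ k ∙ (one : SplitOct k) →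
    ∀ s : Set A, (∀ f ∈ s, σ ⟨f, 0⟩ x ∈ k ∙ (one : SplitOct k)) →
    ∃ y ∈ U, y ∉ k ∙ (one : SplitOct k) ∧
      ∀ f ∈ insert g s, σ ⟨f, 0⟩ y ∈ k ∙ (one : SplitOct k)
  have step : ∀ g, P g := by
    intro g x hxU hx s hs
    by_cases hg : σ ⟨g, 0⟩ x ∈ k ∙ (one : SplitOct k)
    · exact ⟨x, hxU, hx, fun f hf => by
        rcases hf with rfl | hf
        · exact hg
        · exact hs f hf⟩
    · refine ⟨σ ⟨g, 0⟩ x, hU.apply_mem _ _ hxU, hg, fun f hf => ?_⟩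
      rcases hf with rfl | hf
      · rw [h.mul_self]; exact zero_mem _
      · rw [apply_comm, h.apply_scalar _ (hs f hf)]; exact zero_mem _
  obtain ⟨x, hxU, hx⟩ := hU.exists_notMem
  obtain ⟨x1, hx1U, hx1, h1⟩ := step 1 x hxU hx ∅ (by simp)
  obtain ⟨x2, hx2U, hx2, h2⟩ := step T.x x1 hx1U hx1 _ h1
  obtain ⟨x3, hx3U, hx3, h3⟩ := step T.y x2 hx2U hx2 _ h2
  obtain ⟨x4, hx4U, hx4, h4⟩ := step (T.x * T.y) x3 hx3U hx3 _ h3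
  refine hx4 (he ▸ ⟨hx4U, hU.le_ker hx4U, fun f => ?_⟩)
  obtain ⟨a, b, c, d, rfl⟩ := T.exists_eq f
  have e : (⟨a • 1 + b • T.x + c • T.y + d • (T.x * T.y), 0⟩ : DerSemidirect k A) =
      a • ⟨1, 0⟩ + b • ⟨T.x, 0⟩ + c • ⟨T.y, 0⟩ + d • ⟨T.x * T.y, 0⟩ := by simp
  rw [e]
  simp only [map_add, map_smul, LinearMap.add_apply, LinearMap.smul_apply]
  refine add_mem (add_mem (add_mem ?_ ?_) ?_) ?_ <;> refine Submodule.smul_mem _ _ (h4 _ ?_) <;>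
    simp

omit [CharP k 2] in
theorem finrank_splitOct : Module.finrank k (SplitOct k) = 8 := by
  simp [Module.finrank_matrix]

omit [CharP k 2] in
theorem finrank_ker_tr : Module.finrank k (LinearMap.ker (tr (k := k))) = 7 := by
  have h1 := LinearMap.finrank_range_add_finrank_ker (tr (k := k))
  have h2 : LinearMap.range (tr (k := k)) = ⊤ := LinearMap.range_eq_top.2 fun c =>
    ⟨zorn c 0 0 0 0 0 0 0, by rw [tr_zorn, add_zero]⟩
  rw [h2, finrank_top, Module.finrank_self, finrank_splitOct] at h1
  omega

omit [CharP k 2] in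
theorem finrank_span_one : Module.finrank k (k ∙ (one : SplitOct k)) = 1 :=
  finrank_span_singleton one_ne_zero

include h in
theorem kerA_ne : kerA σ ≠ LinearMap.ker tr := by
  obtain ⟨f, x, hx, hf⟩ := h.exists_notMem
  exact fun he => hf ((he ▸ hx : x ∈ kerA σ).2 f)

include h T in
theorem exists_isotropic : ∃ S : Submodule k (SplitOct k), IsStable σ S ∧
    Module.finrank k S = 4 ∧ ∀ x ∈ S, ∀ y ∈ S, polar x y = 0 := by
  -- `R ⊓ kerA σ` is totally isotropic, hence of dimension at most four, and stable, hence of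
  -- dimension at least four. `R` is not `k1`, since otherwise `kerA σ` would have dimension seven
  -- and `A` would act trivially.
  let R := LinearMap.BilinForm.orthogonal polar (kerA σ)
  have hR : IsStable σ R := by
    refine ⟨fun w u hu y hy => ?_, fun y hy => ?_, fun u hu => ?_, fun he => ?_⟩
    · change polar y (σ w u) = 0
      rw [← h.polar_apply]
      exact hu _ (h.apply_mem_kerA w hy)
    · change polar y one = 0
      rw [polar_one]
      exact hy.1
    · have := hu one ⟨tr_one, fun f => by rw [h.apply_one]; exact zero_mem _⟩
      change polar one u = 0 at this
      rwa [polar_comm, polar_one] at this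
    · have h1 := LinearMap.BilinForm.finrank_orthogonal polar_nondegenerate (kerA σ)
      change Module.finrank k R = _ at h1
      rw [he, finrank_span_one, finrank_splitOct] at h1
      refine h.kerA_ne (Submodule.eq_of_le_of_finrank_le (fun x hx => hx.1) ?_)
      rw [finrank_ker_tr]
      omega
  refine ⟨R ⊓ kerA σ, inf_kerA T h hR, le_antisymm ?_ (four_le_finrank T h (inf_kerA T h hR)),
    fun x hx y hy => hy.1 x hx.2⟩
  have h1 := LinearMap.BilinForm.finrank_orthogonal polar_nondegenerate (R ⊓ kerA σ)
  have h2 : R ⊓ kerA σ ≤ LinearMap.BilinForm.orthogonal polar (R ⊓ kerA σ) :=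
    fun y hy x hx => hy.1 x hx.2
  have h3 := Submodule.finrank_mono h2
  rw [h1, finrank_splitOct] at h3
  omega

include h T in
theorem le_kerA {U : Submodule k (SplitOct k)} (hU : IsStable σ U) (hU4 : Module.finrank k U ≤ 4) :
    U ≤ kerA σ := by
  -- The intersection is itself stable, so its dimension is already four.
  have := Submodule.eq_of_le_of_finrank_le (inf_le_left : U ⊓ kerA σ ≤ U)
    (hU4.trans (four_le_finrank T h (inf_kerA T h hU)))
  exact inf_eq_left.1 this

-- Two such subspaces meeting only in `k1` would span `4 + 4 - 1 = 7` dimensions, that is all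
-- traceless octonions, and `A` would kill everything modulo scalars. Any larger intersection is
-- stable, so it has dimension four and equals both.
include h T in
theorem isStable_unique {U U' : Submodule k (SplitOct k)} (hU : IsStable σ U) (hU' : IsStable σ U')
    (hU4 : Module.finrank k U ≤ 4) (hU4' : Module.finrank k U' ≤ 4) : U = U' := by
  by_cases hi : U ⊓ U' = k ∙ one
  · exfalso
    refine h.kerA_ne (le_antisymm (fun x hx => hx.1) ?_)
    have h1 := Submodule.finrank_sup_add_finrank_inf_eq U U'
    have h2 := four_le_finrank T h hU
    have h3 := four_le_finrank T h hU'
    rw [hi, finrank_span_one] at h1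
    have h4 : U ⊔ U' = LinearMap.ker tr :=
      Submodule.eq_of_le_of_finrank_le (sup_le hU.le_ker hU'.le_ker) (by
        rw [finrank_ker_tr]; omega)
    rw [← h4]
    exact sup_le (le_kerA T h hU hU4) (le_kerA T h hU' hU4')
  · have hs : IsStable σ (U ⊓ U') :=
      ⟨fun w u hu => ⟨hU.apply_mem w u hu.1, hU'.apply_mem w u hu.2⟩, ⟨hU.one_mem, hU'.one_mem⟩,
        inf_le_left.trans hU.le_ker, hi⟩
    have h1 := four_le_finrank T h hs
    exact (Submodule.eq_of_le_of_finrank_le inf_le_left (hU4.trans h1)).symm.trans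
      (Submodule.eq_of_le_of_finrank_le inf_le_right (hU4'.trans h1))

end IsOctonionRep

/-! ### The image is not the Lie algebra of a subgroup. -/

namespace IsOctonionRep

variable {k A : Type*} [Field k] [CharP k 2] [CommRing A] [Algebra k A] (T : TruncData k A)
  {σ : DerSemidirect k A →ₗ⁅k⁆ Module.End k (SplitOct k)} (h : IsOctonionRep σ)

omit [CharP k 2] in
theorem mul_eq_zero_of_mem_scalar {x y : SplitOct k} (hy : nrm (mul x y) = 0)
    (hxy : mul x y ∈ k ∙ (one : SplitOct k)) : mul x y = 0 := by
  obtain ⟨c, hc⟩ := Submodule.mem_span_singleton.1 hxy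
  rw [← hc, nrm_smul, nrm_one, _root_.mul_one, sq_eq_zero_iff] at hy
  rw [← hc, hy, zero_smul]

include h T in
/-- No stable isotropic subspace has its singular vectors stable under the derivations. -/
theorem false_of_stable_singular {S U : Submodule k (SplitOct k)} (hS : IsStable σ S)
    (hS4 : Module.finrank k S = 4) (hU : ∀ x, x ∈ U ↔ x ∈ S ∧ nrm x = 0)
    (hU3 : Module.finrank k U = 3) (hpol : ∀ x ∈ S, ∀ y ∈ S, polar x y = 0)
    (hσ : ∀ w, ∀ u ∈ U, σ w u ∈ U) : False := by
  obtain ⟨b⟩ : Nonempty (Module.Basis (Fin 3) k U) := ⟨Module.finBasisOfFinrankEq k U hU3⟩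
  let u : Fin 3 → SplitOct k := fun i => b i
  have huU : ∀ i, u i ∈ U := fun i => (b i).2
  have hu : LinearIndependent k u := b.linearIndependent.map' U.subtype (Submodule.ker_subtype U)
  have htr : ∀ x ∈ U, tr x = 0 := fun x hx => hS.le_ker ((hU x).1 hx).1
  have hsum : ∀ x ∈ U, ∃ c : Fin 3 → k, x = c 0 • u 0 + c 1 • u 1 + c 2 • u 2 := by
    intro x hx
    have := congrArg Subtype.val (b.sum_repr ⟨x, hx⟩)
    rw [Fin.sum_univ_three] at this
    exact ⟨_, this.symm⟩
  have hself : ∀ x ∈ U, mul x x = 0 := fun x hx => by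
    rw [SplitOct.mul_self, htr x hx, ((hU x).1 hx).2, zero_smul, zero_smul, add_zero]
  have hmm : ∀ x ∈ U, ∀ y, mul x (mul x y) = 0 := fun x hx y => by
    rw [mul_mul_self_left, htr x hx, ((hU x).1 hx).2, zero_smul, zero_smul, add_zero]
  have hcomm : ∀ x ∈ U, ∀ y ∈ U, mul x y = mul y x := fun x hx y hy => by
    have h1 := mul_add_mul_comm x y
    rw [htr x hx, htr y hy, hpol x ((hU x).1 hx).1 y ((hU y).1 hy).1, zero_smul, zero_smul,
      zero_smul, add_zero, add_zero] at h1
    rw [add_eq_zero_iff_eq_neg, ← neg_one_smul k, CharTwo.neg_eq, one_smul] at h1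
    exact h1
  -- On `U` squares vanish and the product is commutative, so `U · U + k1` is spanned by three
  -- products and the unit. It is stable by the Leibniz rule.
  let v : Fin 4 → SplitOct k := ![mul (u 0) (u 1), mul (u 0) (u 2), mul (u 1) (u 2), one]
  let K : Submodule k (SplitOct k) := Submodule.span k (Set.range v)
  have hv : ∀ i, v i ∈ K := fun i => Submodule.subset_span ⟨i, rfl⟩
  have hmulK : ∀ x ∈ U, ∀ y ∈ U, mul x y ∈ K := by
    intro x hx y hy
    obtain ⟨c, rfl⟩ := hsum x hx
    obtain ⟨d, rfl⟩ := hsum y hy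
    simp only [← mulₗ_apply, map_add, map_smul, LinearMap.add_apply, LinearMap.smul_apply]
    simp only [mulₗ_apply, hself _ (huU _), hcomm _ (huU 1) _ (huU 0), hcomm _ (huU 2) _ (huU 0),
      hcomm _ (huU 2) _ (huU 1), smul_zero, zero_add, add_zero]
    have h0 : mul (u 0) (u 1) ∈ K := hv 0
    have h1 : mul (u 0) (u 2) ∈ K := hv 1
    have h2 : mul (u 1) (u 2) ∈ K := hv 2
    apply_rules [Submodule.add_mem, Submodule.smul_mem]
  have hK4 : Module.finrank k K ≤ 4 := by
    have := finrank_range_le_card (R := k) v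
    rwa [Fintype.card_fin] at this
  have hKle : K ≤ LinearMap.ker tr := by
    rw [Submodule.span_le]
    have hij : ∀ i j, tr (mul (u i) (u j)) = 0 := fun i j => by
      rw [tr_mul, htr _ (huU i), zero_mul, add_zero]
      exact hpol _ ((hU _).1 (huU i)).1 _ ((hU _).1 (huU j)).1
    rintro _ ⟨i, rfl⟩
    fin_cases i
    · exact hij 0 1
    · exact hij 0 2
    · exact hij 1 2
    · exact tr_one
  have hKσ : ∀ w, ∀ x ∈ K, σ w x ∈ K := by
    intro w x hx
    have hij : ∀ i j, σ w (mul (u i) (u j)) ∈ K := fun i j => by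
      obtain ⟨M, hM, e⟩ := h.exists_pslAct w
      rw [← e, pslAct_mul hM, e]
      exact add_mem (hmulK _ (hσ w _ (huU i)) _ (huU j)) (hmulK _ (huU i) _ (hσ w _ (huU j)))
    have : K ≤ K.comap (σ w) := by
      rw [Submodule.span_le]
      rintro _ ⟨i, rfl⟩
      fin_cases i
      · exact hij 0 1
      · exact hij 0 2
      · exact hij 1 2
      · change σ w one ∈ K
        rw [h.apply_one]
        exact zero_mem _
    exact this hx
  have hn : ∀ i j, nrm (mul (u i) (u j)) = 0 := fun i j => by
    rw [nrm_mul, ((hU _).1 (huU i)).2, zero_mul]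
  by_cases hK1 : K = k ∙ one
  · refine not_linearIndependent_of_mul_eq_zero (fun i => htr _ (huU i)) (fun i j => ?_) hu
    exact mul_eq_zero_of_mem_scalar (hn i j) (hK1 ▸ hmulK _ (huU i) _ (huU j))
  · have hKS : K = S := isStable_unique T h ⟨hKσ, hv 3, hKle, hK1⟩ hS hK4 hS4.le
    have hvi : LinearIndependent k v := by
      rw [linearIndependent_iff_card_eq_finrank_span]
      change _ = Module.finrank k K
      rw [hKS, hS4, Fintype.card_fin]
    have hpair : LinearIndependent k ![mul (u 0) (u 1), mul (u 0) (u 2)] := by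
      have := hvi.comp ![0, 1] (by decide)
      convert this using 1
      funext i
      fin_cases i <;> rfl
    rw [LinearIndependent.pair_iff] at hpair
    -- The product lies in `S` and is singular, hence lies in `U`. Multiplying its expansion by `u
    -- 0` on the left gives zero, which kills the coefficients of `u 1` and `u 2`. Both `u 0 u 1`
    -- and `u 0 u 2` are then multiples of `u 0`, against their independence.
    have key : ∀ j, j ≠ 0 → ∃ c : k, mul (u 0) (u j) = c • u 0 := by
      intro j _
      have hm : mul (u 0) (u j) ∈ U := (hU _).2 ⟨hKS ▸ hmulK _ (huU 0) _ (huU j), hn 0 j⟩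
      obtain ⟨c, hc⟩ := hsum _ hm
      have h0 := hmm _ (huU 0) (u j)
      rw [hc] at h0
      simp only [← mulₗ_apply, map_add, map_smul] at h0
      simp only [mulₗ_apply, hself _ (huU 0), smul_zero, zero_add] at h0
      obtain ⟨h1, h2⟩ := hpair _ _ h0
      rw [h1, h2, zero_smul, zero_smul, add_zero, add_zero] at hc
      exact ⟨_, hc⟩
    obtain ⟨c, hc⟩ := key 1 (by decide)
    obtain ⟨d, hd⟩ := key 2 (by decide)
    obtain ⟨hd0, hc0⟩ := hpair d (-c) (by rw [hc, hd, smul_smul, smul_smul, neg_mul, mul_comm, neg_smul, add_neg_cancel])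
    have hbad := hpair 1 0 (by rw [hc, neg_eq_zero.1 hc0]; simp)
    exact _root_.one_ne_zero hbad.1

include h T in
/-- The image of `Der(A) ⋉ A` is not the Lie algebra of a subgroup of `G₂`. -/
theorem not_lieAlg [IsAlgClosed k] {P : Subgroup (SplitOct k ≃ₗ[k] SplitOct k)}
    (hP : P ≤ groupG2 k) (hL : ∀ D, D ∈ lieAlg P ↔ ∃ w, σ w = D) : False := by
  obtain ⟨S, hS, hS4, hpol⟩ := exists_isotropic T h
  have hg : ∀ g ∈ P, ∀ x ∈ S, g x ∈ S := by
    intro g hg x hx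
    have hfr : Module.finrank k (S.map (g : SplitOct k →ₗ[k] SplitOct k)) = 4 := by
      rw [LinearEquiv.finrank_map_eq g S, hS4]
    -- Conjugation by `g ∈ P` preserves `Lie(P)`, so it permutes the stable subspaces.
    have hgS : IsStable σ (S.map (g : SplitOct k →ₗ[k] SplitOct k)) := by
      refine ⟨?_, ⟨one, hS.one_mem, map_one (hP hg)⟩, ?_, fun he => ?_⟩
      · rintro w _ ⟨s, hs, rfl⟩
        have := conj_mem_lieAlg (P.inv_mem hg) ((hL _).2 ⟨w, rfl⟩)
        obtain ⟨w', hw'⟩ := (hL _).1 this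
        refine ⟨σ w' s, hS.apply_mem _ _ hs, ?_⟩
        rw [hw', inv_inv]
        exact g.apply_symm_apply _
      · rintro _ ⟨s, hs, rfl⟩
        exact ((tr_nrm_map (hP hg) s).1).trans (hS.le_ker hs)
      · rw [he, finrank_span_one] at hfr
        omega
    rw [← isStable_unique T h hgS hS hfr.le hS4.le]
    exact ⟨x, hx, rfl⟩
  let U : Submodule k (SplitOct k) :=
    { carrier := {x | x ∈ S ∧ nrm x = 0}
      zero_mem' := ⟨zero_mem _, by rw [zero_eq_zorn, nrm_zorn]; simp⟩
      add_mem' := fun {x y} hx hy => ⟨add_mem hx.1 hy.1, by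
        rw [nrm_add, hx.2, hy.2, hpol x hx.1 y hy.1, add_zero, add_zero]⟩
      smul_mem' := fun c x hx => ⟨S.smul_mem c hx.1, by rw [nrm_smul, hx.2, mul_zero]⟩ }
  have hU3 : Module.finrank k U = 3 := by
    have hinf : U ⊓ (k ∙ one) = ⊥ := by
      rw [eq_bot_iff]
      rintro x ⟨hx, hx1⟩
      obtain ⟨c, rfl⟩ := Submodule.mem_span_singleton.1 hx1
      have := hx.2
      rw [nrm_smul, nrm_one, _root_.mul_one, sq_eq_zero_iff] at this
      rw [this, zero_smul]
      exact zero_mem _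
    have hsup : U ⊔ (k ∙ one) = S := by
      refine le_antisymm (sup_le (fun x hx => hx.1) (by simpa using hS.one_mem)) fun x hx => ?_
      -- Subtracting a square root of the norm times the unit makes a vector of `S` singular; thus
      -- `S = U ⊕ k1`.
      obtain ⟨c, hc⟩ := IsAlgClosed.exists_pow_nat_eq (nrm x) (n := 2) (by decide)
      have hx' : x - c • one ∈ U := by
        refine ⟨sub_mem hx (S.smul_mem c hS.one_mem), ?_⟩
        rw [sub_eq_add_neg, ← neg_smul, nrm_add, nrm_smul, nrm_one, polar_smul_one, hS.le_ker hx,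
          ← hc, CharTwo.neg_eq, _root_.mul_one, mul_zero, add_zero, CharTwo.add_self_eq_zero]
      rw [← sub_add_cancel x (c • one)]
      exact add_mem (Submodule.mem_sup_left hx')
        (Submodule.mem_sup_right (Submodule.mem_span_singleton.2 ⟨c, rfl⟩))
    have := Submodule.finrank_sup_add_finrank_inf_eq U (k ∙ one)
    rw [hinf, hsup, finrank_bot, finrank_span_one, hS4] at this
    omega
  refine false_of_stable_singular T h hS hS4 (U := U) (fun x => Iff.rfl) hU3 hpol fun w u hu => ?_
  refine apply_mem_of_mem_lieAlg (G := P) (fun g hgP u hu => ?_) ((hL _).2 ⟨w, rfl⟩) hu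
  exact ⟨hg g hgP u hu.1, (tr_nrm_map (hP hgP) u).2.trans hu.2⟩

end IsOctonionRep

/-! ### The concrete algebra `k[X, Y]/(X², Y²)`. -/

namespace TruncPoly

variable {k : Type*} [Field k]

theorem exists_eq_of_surjective {A : Type*} [CommRing A] [Algebra k A]
    (π : MvPolynomial (Fin 2) k →ₐ[k] A) (hπ : Function.Surjective π) {x y : A}
    (hx : π (MvPolynomial.X 0) = x) (hy : π (MvPolynomial.X 1) = y) (hxx : x * x = 0)
    (hyy : y * y = 0) (f : A) : ∃ a b c d : k, f = a • 1 + b • x + c • y + d • (x * y) := by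
  obtain ⟨p, rfl⟩ := hπ f
  induction p using MvPolynomial.induction_on with
  | C r =>
    refine ⟨r, 0, 0, 0, ?_⟩
    rw [← MvPolynomial.algebraMap_eq, AlgHom.commutes, Algebra.algebraMap_eq_smul_one]
    simp
  | add p q hp hq =>
    obtain ⟨a, b, c, d, hp⟩ := hp
    obtain ⟨a', b', c', d', hq⟩ := hq
    refine ⟨a + a', b + b', c + c', d + d', ?_⟩
    rw [map_add, hp, hq]
    simp only [add_smul]
    abel
  | mul_X p i hp =>
    obtain ⟨a, b, c, d, hp⟩ := hp
    rw [map_mul, hp]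
    fin_cases i
    · refine ⟨0, a, 0, c, ?_⟩
      simp only [Fin.zero_eta, hx, Algebra.smul_def, map_zero]
      linear_combination (algebraMap k A b + algebraMap k A d * y) * hxx
    · refine ⟨0, 0, a, b, ?_⟩
      simp only [Fin.mk_one, hy, Algebra.smul_def, map_zero]
      linear_combination (algebraMap k A c + algebraMap k A d * x) * hyy

/-- The class of the variable `X i`. -/
noncomputable def gen (i : Fin 2) : TruncPoly k := Ideal.Quotient.mk _ (MvPolynomial.X i)

theorem gen_mul_self (i : Fin 2) : (gen i : TruncPoly k) * gen i = 0 := by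
  rw [gen, ← map_mul, Ideal.Quotient.eq_zero_iff_mem, ← sq]
  exact Ideal.subset_span ⟨i, rfl⟩

/-- The augmentation. -/
noncomputable def aug : TruncPoly k →ₐ[k] k :=
  Ideal.Quotient.liftₐ _ (MvPolynomial.aeval fun _ => (0 : k)) (by
    intro p hp
    rw [← RingHom.mem_ker]
    revert p
    change _ ≤ RingHom.ker _
    rw [Ideal.span_le]
    rintro _ ⟨i, rfl⟩
    simp)

theorem aug_gen (i : Fin 2) : aug (gen i : TruncPoly k) = 0 := by
  have : aug (gen i : TruncPoly k) = MvPolynomial.aeval (fun _ => (0 : k)) (MvPolynomial.X i) := rfl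
  rw [this, MvPolynomial.aeval_X]

variable [CharP k 2]

/-- The derivative of `X²` is `2X = 0`: only in characteristic two do the partial derivatives
descend to the quotient. -/
theorem pderiv_mem (i : Fin 2) {p : MvPolynomial (Fin 2) k}
    (hp : p ∈ Ideal.span (Set.range fun i : Fin 2 => (MvPolynomial.X i : MvPolynomial (Fin 2) k) ^ 2)) :
    MvPolynomial.pderiv i p ∈
      Ideal.span (Set.range fun i : Fin 2 => (MvPolynomial.X i : MvPolynomial (Fin 2) k) ^ 2) := by
  induction hp using Submodule.span_induction with
  | mem p hp =>
    obtain ⟨j, rfl⟩ := hp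
    have h2 : (2 : MvPolynomial (Fin 2) k) = 0 := CharTwo.two_eq_zero
    simp [MvPolynomial.pderiv_pow, h2]
  | zero => simp
  | add p q _ _ hp hq => rw [map_add]; exact add_mem hp hq
  | smul a p hp' hp =>
    rw [smul_eq_mul, Derivation.leibniz, smul_eq_mul, smul_eq_mul]
    exact add_mem (Ideal.mul_mem_left _ _ hp) (Ideal.mul_mem_right _ _ hp')

theorem mk_pderiv_eq_zero (i : Fin 2) (p : MvPolynomial (Fin 2) k)
    (hp : Ideal.Quotient.mkₐ k (Ideal.span (Set.range fun i : Fin 2 =>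
      (MvPolynomial.X i : MvPolynomial (Fin 2) k) ^ 2)) p = 0) :
    Ideal.Quotient.mkₐ k (Ideal.span (Set.range fun i : Fin 2 =>
      (MvPolynomial.X i : MvPolynomial (Fin 2) k) ^ 2)) (MvPolynomial.pderiv i p) = 0 := by
  rw [Ideal.Quotient.mkₐ_eq_mk, Ideal.Quotient.eq_zero_iff_mem] at *
  exact pderiv_mem i hp

/-- The partial derivatives. -/
noncomputable def pd (i : Fin 2) : Derivation k (TruncPoly k) (TruncPoly k) :=
  Derivation.liftOfSurjective (f := Ideal.Quotient.mkₐ k _) (d := MvPolynomial.pderiv i)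
    Ideal.Quotient.mk_surjective (mk_pderiv_eq_zero i)

theorem pd_gen (i j : Fin 2) : pd i (gen j : TruncPoly k) = if i = j then 1 else 0 := by
  have : pd i (gen j : TruncPoly k) =
      Ideal.Quotient.mkₐ k _ (MvPolynomial.pderiv i (MvPolynomial.X j)) :=
    Derivation.liftOfSurjective_apply _ (mk_pderiv_eq_zero i) (MvPolynomial.X j)
  rw [this, MvPolynomial.pderiv_X]
  rcases eq_or_ne i j with rfl | h
  · simp
  · rw [Pi.single_eq_of_ne h.symm, map_zero, if_neg h]

/-- The standard presentation of the truncated polynomial ring. -/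
noncomputable def truncData (k : Type*) [Field k] [CharP k 2] : TruncData k (TruncPoly k) where
  x := gen 0
  y := gen 1
  x_mul_x := gen_mul_self 0
  y_mul_y := gen_mul_self 1
  exists_eq := exists_eq_of_surjective (Ideal.Quotient.mkₐ k _) Ideal.Quotient.mk_surjective rfl rfl
    (gen_mul_self 0) (gen_mul_self 1)
  aug := aug
  aug_x := aug_gen 0
  aug_y := aug_gen 1
  dx := pd 0
  dy := pd 1
  dx_x := by rw [pd_gen, if_pos rfl]
  dx_y := by rw [pd_gen, if_neg (by decide)]
  dy_x := by rw [pd_gen, if_neg (by decide)]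
  dy_y := by rw [pd_gen, if_pos rfl]

end TruncPoly

/-! ### Centre of `psl₄` and homomorphisms of quotient Lie algebras. -/

theorem Matrix.exists_eq_smul_one_of_lie {k : Type*} [Field k] {C : Matrix (Fin 4) (Fin 4) k}
    (h : ∀ B : Matrix (Fin 4) (Fin 4) k, B.trace = 0 → ∃ c : k, ⁅C, B⁆ = c • 1) :
    ∃ c : k, C = c • 1 := by
  -- Off-diagonal entries in column `j` of the bracket with the matrix unit at `(i, j)`.
  have key : ∀ i j p : Fin 4, i ≠ j → p ≠ j → C p i - (if p = i then C j j else 0) = 0 := by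
    intro i j p hij hpj
    obtain ⟨c, hc⟩ := h (Matrix.single i j 1) (Matrix.trace_single_eq_of_ne i j 1 hij)
    have := congrFun (congrFun hc p) j
    rw [Ring.lie_def, Matrix.sub_apply, Matrix.mul_single_apply_same, Matrix.smul_apply,
      Matrix.one_apply_ne hpj] at this
    rcases eq_or_ne p i with rfl | hpi
    · simpa using this
    · rw [Matrix.single_mul_apply_of_ne _ _ _ _ _ hpi] at this
      simpa [hpi] using this
  refine ⟨C 0 0, ?_⟩
  have hd : ∀ i, C i i = C 0 0 := by
    intro i
    rcases eq_or_ne i 0 with rfl | hi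
    · rfl
    · simpa [sub_eq_zero] using key i 0 i hi hi
  ext p i
  rcases eq_or_ne p i with rfl | hpi
  · simp [hd p]
  · obtain ⟨j, hj, hj'⟩ : ∃ j : Fin 4, i ≠ j ∧ p ≠ j := by
      revert p i; decide
    simpa [hpi] using key i j p hj hj'

/-- The quotient map of a Lie algebra by an ideal, as a homomorphism of Lie algebras. -/
def LieIdeal.quotientMap {R L : Type*} [CommRing R] [LieRing L] [LieAlgebra R L]
    (I : LieIdeal R L) : L →ₗ⁅R⁆ L ⧸ I where
  __ := (I : Submodule R L).mkQ
  map_lie' := rfl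

theorem LieIdeal.quotientMap_eq_zero_iff {R L : Type*} [CommRing R] [LieRing L] [LieAlgebra R L]
    {I : LieIdeal R L} {x : L} : I.quotientMap x = 0 ↔ x ∈ I :=
  Submodule.Quotient.mk_eq_zero (I : Submodule R L)

/-- The homomorphism of quotient Lie algebras induced by a homomorphism. -/
def LieIdeal.mapQuotient {R L L' : Type*} [CommRing R] [LieRing L] [LieAlgebra R L] [LieRing L']
    [LieAlgebra R L'] (I : LieIdeal R L) (J : LieIdeal R L') (f : L →ₗ⁅R⁆ L')
    (h : ∀ x ∈ I, f x ∈ J) : L ⧸ I →ₗ⁅R⁆ L' ⧸ J where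
  __ := Submodule.mapQ (I : Submodule R L) (J : Submodule R L') (f : L →ₗ[R] L') h
  map_lie' {x y} := by
    induction x using Submodule.Quotient.induction_on with | _ x
    induction y using Submodule.Quotient.induction_on with | _ y
    change J.quotientMap (f ⁅x, y⁆) = ⁅J.quotientMap (f x), J.quotientMap (f y)⁆
    rw [LieHom.map_lie, LieHom.map_lie]

theorem LieIdeal.mapQuotient_injective {R L L' : Type*} [CommRing R] [LieRing L] [LieAlgebra R L]
    [LieRing L'] [LieAlgebra R L'] {I : LieIdeal R L} {J : LieIdeal R L'} {f : L →ₗ⁅R⁆ L'}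
    (h : ∀ x ∈ I, f x ∈ J) (h' : ∀ x, f x ∈ J → x ∈ I) :
    Function.Injective (I.mapQuotient J f h) := by
  rw [injective_iff_map_eq_zero]
  intro x hx
  induction x using Submodule.Quotient.induction_on with | _ x
  exact quotientMap_eq_zero_iff.2 (h' x (quotientMap_eq_zero_iff.1 hx))

theorem add_self_eq_zero_of_charTwo (k : Type*) {V : Type*} [Field k] [CharP k 2] [AddCommGroup V]
    [Module k V] (v : V) : v + v = 0 := by
  have h := add_smul (1 : k) 1 v
  rw [CharTwo.add_self_eq_zero, zero_smul, one_smul] at h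
  exact h.symm

/-! ### The image of `(W ⋉ O) / k1` in the Lie algebra of type `G₂`. -/

namespace TruncData

variable {k A : Type*} [Field k] [CharP k 2] [CommRing A] [Algebra k A] (T : TruncData k A)

/-- The representation of `Der(A) ⋉ A`, with values in `sl(A)`. -/
noncomputable def derRepSl : DerSemidirect k A →ₗ⁅k⁆ slEnd k A where
  toFun w := ⟨derRep k A w, T.derRep_mem_slEnd w⟩
  map_add' v w := Subtype.ext ((derRep k A).map_add v w)
  map_smul' c w := Subtype.ext ((derRep k A).map_smul c w)
  map_lie' {v w} := Subtype.ext ((derRep k A).map_lie v w)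

theorem derRepSl_mem_iff {w : DerSemidirect k A} :
    T.derRepSl w ∈ slEndScalars k A ↔ w ∈ scalarIdeal k A := derRep_eq_smul_one_iff

/-- The homomorphism `(Der(A) ⋉ A) / k 1 → psl(A)`. -/
noncomputable def quotRep : (DerSemidirect k A ⧸ scalarIdeal k A) →ₗ⁅k⁆ pslEnd k A :=
  (scalarIdeal k A).mapQuotient (slEndScalars k A) T.derRepSl fun _ => T.derRepSl_mem_iff.2

theorem quotRep_injective : Function.Injective T.quotRep := by
  exact LieIdeal.mapQuotient_injective _ fun _ => T.derRepSl_mem_iff.1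

include T in
theorem exists_mul_self (f : A) : ∃ c : k, f * f = c • 1 := by
  have h2 : (2 : k) = 0 := CharTwo.two_eq_zero
  obtain ⟨a, b, c, d, rfl⟩ := T.exists_comb f
  refine ⟨a * a, ?_⟩
  rw [T.comb_mul, T.one_eq, T.smul_comb, T.comb_inj]
  refine ⟨by ring, ?_, ?_, ?_⟩ <;> grind

-- The double bracket is `f² B + B f² - 2 f B f`; here `f²` is scalar and the characteristic is two.
include T in
theorem lie_derRep_lie (f : A) (B : Module.End k A) :
    ⁅derRep k A ⟨f, 0⟩, ⁅derRep k A ⟨f, 0⟩, B⁆⁆ = 0 := by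
  obtain ⟨c, hc⟩ := T.exists_mul_self f
  have h2 : ∀ g : A, g + g = 0 := add_self_eq_zero_of_charTwo k
  have hm : ∀ g, derRep k A ⟨f, 0⟩ g = f * g := fun g => by simp [derRep_apply]
  ext g
  have e1 : f * (f * B g) = c • B g := by rw [← mul_assoc, hc, smul_one_mul]
  have e2 : B (f * (f * g)) = c • B g := by rw [← mul_assoc, hc, smul_one_mul, map_smul]
  simp only [Ring.lie_def, LinearMap.sub_apply, Module.End.mul_apply, hm, mul_sub, e1, e2,
    LinearMap.zero_apply]
  linear_combination h2 (c • B g) - h2 (f * B (f * g))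

omit [CharP k 2] in
theorem x_notMem (T : TruncData k A) : (⟨T.x, 0⟩ : DerSemidirect k A) ∉ scalarIdeal k A := by
  rintro ⟨-, c, hc⟩
  have := congrArg T.aug (congrArg T.dx hc)
  simp [T.dx_x] at this

variable (φ : pslEnd k A ≃ₗ⁅k⁆ lieAlg (groupG2 k))

/-- The homomorphism from `sl(A)` to the endomorphisms of the octonion algebra given by an
isomorphism of `psl(A)` with the Lie algebra of type `G₂`. -/
noncomputable def slRep (φ : pslEnd k A ≃ₗ⁅k⁆ lieAlg (groupG2 k)) : slEnd k A →ₗ⁅k⁆ Module.End k (SplitOct k) :=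
  (lieAlg (groupG2 k)).incl.comp
    ((φ : pslEnd k A →ₗ⁅k⁆ lieAlg (groupG2 k)).comp (slEndScalars k A).quotientMap)

omit [CharP k 2] in
theorem slRep_apply (B : slEnd k A) :
    slRep φ B = (φ ((slEndScalars k A).quotientMap B) : Module.End k (SplitOct k)) := rfl

omit [CharP k 2] in
theorem slRep_eq_zero_iff {B : slEnd k A} : slRep φ B = 0 ↔ B ∈ slEndScalars k A := by
  rw [slRep_apply, ZeroMemClass.coe_eq_zero, map_eq_zero_iff φ φ.injective,
    LieIdeal.quotientMap_eq_zero_iff]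

omit [CharP k 2] in
theorem slRep_mem (B : slEnd k A) : slRep φ B ∈ lieAlg (groupG2 k) := (φ _).2

omit [CharP k 2] in
theorem exists_slRep_eq {D : Module.End k (SplitOct k)} (hD : D ∈ lieAlg (groupG2 k)) :
    ∃ B, slRep φ B = D := by
  obtain ⟨B, hB⟩ := Submodule.Quotient.mk_surjective _ (φ.symm ⟨D, hD⟩)
  refine ⟨B, ?_⟩
  have : φ (Submodule.Quotient.mk B) = ⟨D, hD⟩ := by rw [hB, φ.apply_symm_apply]
  exact congrArg Subtype.val this

/-- The action of `Der(A) ⋉ A` on the octonion algebra. -/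
noncomputable def octRep : DerSemidirect k A →ₗ⁅k⁆ Module.End k (SplitOct k) := (slRep φ).comp T.derRepSl

theorem octRep_apply (w : DerSemidirect k A) : T.octRep φ w = slRep φ (T.derRepSl w) := rfl

theorem octRep_eq_zero_iff {w : DerSemidirect k A} :
    T.octRep φ w = 0 ↔ w ∈ scalarIdeal k A := by
  rw [octRep_apply, slRep_eq_zero_iff, derRepSl_mem_iff]

theorem exists_octRep_eq [Infinite k] (m : (Fin 4 → k) →ₗ[k] Matrix (Fin 4) (Fin 4) k)
    (hm : ∀ c, (m c).trace = 0) : ∃ c, c ≠ 0 ∧ ∃ w, T.octRep φ w = pslAct (m c) := by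
  obtain ⟨s, hs⟩ := ((slEndScalars k A : Submodule k (slEnd k A)).mkQ).exists_rightInverse_of_surjective
    (Submodule.range_mkQ _)
  let μ : (Fin 4 → k) →ₗ[k] lieAlg (groupG2 k) :=
    LinearMap.codRestrict (lieAlg (groupG2 k)).toSubmodule (pslAct ∘ₗ m)
      fun c => mem_lieAlg_groupG2_iff.2 ⟨m c, hm c, rfl⟩
  let u : (Fin 4 → k) →ₗ[k] slEnd k A :=
    s ∘ₗ (φ.symm.toLinearEquiv : _ →ₗ[k] pslEnd k A) ∘ₗ μ
  -- The symbol of a traceless lift without its `xy`-coefficient, which vanishes anyway. A map from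
  -- dimension four to dimension three has a kernel, and an operator with zero symbol comes from
  -- `Der(A) ⋉ A`.
  let κ : (Fin 4 → k) →ₗ[k] (Fin 3 → k) :=
    LinearMap.funLeft k k Fin.castSucc ∘ₗ (T.coords.symm : A →ₗ[k] Fin 4 → k) ∘ₗ T.symbol ∘ₗ
      (slEnd k A).toSubmodule.subtype ∘ₗ u
  have hker : LinearMap.ker κ ≠ ⊥ := LinearMap.ker_ne_bot_of_finrank_lt (by simp)
  obtain ⟨c, hc, hc0⟩ := Submodule.exists_mem_ne_zero_of_ne_bot hker
  refine ⟨c, hc0, ?_⟩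
  have h0 : T.symbol (u c : Module.End k A) = 0 := by
    rw [← map_eq_zero_iff T.coords.symm T.coords.symm.injective]
    funext i
    refine Fin.lastCases ?_ (fun i => congrFun hc i) i
    exact T.mem_slEnd_iff.1 (u c).2
  obtain ⟨w, hw⟩ := T.symbol_eq_zero_iff.1 h0
  refine ⟨w, ?_⟩
  have hw' : T.derRepSl w = u c := Subtype.ext hw
  have hq : (slEndScalars k A).quotientMap (u c) = φ.symm (μ c) := LinearMap.congr_fun hs _
  rw [octRep_apply, hw', slRep_apply, hq, φ.apply_symm_apply]
  rfl

/-- In characteristic two the square of a derivation `a` is a derivation and `ad (a²) = (ad a)² =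
0`. So `a²` is central in `psl₄`, hence zero. -/
theorem octRep_mul_self [Infinite k] (f : A) (x : SplitOct k) :
    T.octRep φ ⟨f, 0⟩ (T.octRep φ ⟨f, 0⟩ x) = 0 := by
  set a := T.octRep φ ⟨f, 0⟩ with ha
  have had : IsDer a := isDer_of_mem_lieAlg (slRep_mem φ _)
  have hcomm : ∀ D ∈ lieAlg (groupG2 k), ⁅a * a, D⁆ = 0 := by
    intro D hD
    obtain ⟨B, rfl⟩ := exists_slRep_eq φ hD
    have hB : ⁅T.derRepSl ⟨f, 0⟩, ⁅T.derRepSl ⟨f, 0⟩, B⁆⁆ = 0 :=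
      Subtype.ext (T.lie_derRep_lie f B)
    have h := congrArg (slRep φ) hB
    rw [LieHom.map_lie, LieHom.map_lie, map_zero, ← octRep_apply, ← ha] at h
    have e : ⁅a * a, slRep φ B⁆ = ⁅a, ⁅a, slRep φ B⁆⁆ + (a * slRep φ B * a + a * slRep φ B * a) -
        (slRep φ B * a * a + slRep φ B * a * a) := by
      simp only [Ring.lie_def, mul_sub, sub_mul, mul_assoc]
      abel
    rw [e, h, add_self_eq_zero_of_charTwo k (a * _ * a),
      add_self_eq_zero_of_charTwo k (_ * a * a), add_zero, sub_zero]
  have hder : IsDer (a * a) := by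
    intro y z
    have h := add_self_eq_zero_of_charTwo k (mul (a y) (a z))
    simp only [Module.End.mul_apply]
    rw [had y z, map_add, had _ z, had y _, add_assoc, ← add_assoc (mul (a y) (a z)), h, zero_add]
  obtain ⟨C, hC, hCa⟩ := hder.exists_pslAct
  obtain ⟨c, rfl⟩ : ∃ c : k, C = c • 1 := by
    refine Matrix.exists_eq_smul_one_of_lie fun B hB => ?_
    rw [← pslAct_eq_zero_iff, pslAct_lie hC hB, hCa]
    exact hcomm _ (mem_lieAlg_groupG2_iff.2 ⟨B, hB, rfl⟩)
  rw [pslAct_smul_one] at hCa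
  exact LinearMap.congr_fun hCa.symm x

theorem isOctonionRep [Infinite k] : IsOctonionRep (T.octRep φ) where
  exists_pslAct w := mem_lieAlg_groupG2_iff.1 (slRep_mem φ _)
  exists_eq := T.exists_octRep_eq φ
  mul_self := T.octRep_mul_self φ
  exists_notMem := by
    by_contra! h
    obtain ⟨M, -, hM⟩ := mem_lieAlg_groupG2_iff.1 (slRep_mem φ (T.derRepSl ⟨T.x, 0⟩))
    refine T.x_notMem ((T.octRep_eq_zero_iff φ).1 ?_)
    rw [octRep_apply, ← hM, pslAct_eq_zero_iff]
    refine exists_eq_smul_one_of_pslAct fun z hz => ?_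
    obtain ⟨c, hc⟩ := Submodule.mem_span_singleton.1 (h T.x z hz)
    exact ⟨c, by rw [hc, hM]; rfl⟩

/-- The image of `(Der(A) ⋉ A) / k 1` in the Lie algebra of type `G₂`. -/
noncomputable def image : LieSubalgebra k (lieAlg (groupG2 k)) :=
  T.quotRep.range.map (φ : pslEnd k A →ₗ⁅k⁆ lieAlg (groupG2 k))

theorem mem_image {D : lieAlg (groupG2 k)} :
    D ∈ T.image φ ↔ ∃ w, T.octRep φ w = (D : Module.End k (SplitOct k)) := by
  constructor
  · rintro ⟨_, ⟨w, rfl⟩, rfl⟩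
    induction w using Submodule.Quotient.induction_on with | _ w
    exact ⟨w, rfl⟩
  · rintro ⟨w, hw⟩
    exact ⟨_, ⟨(scalarIdeal k A).quotientMap w, rfl⟩, Subtype.ext hw⟩

theorem isCoatom_image : IsCoatom (T.image φ) := by
  have hmem : ∀ B : slEnd k A, φ ((slEndScalars k A).quotientMap B) ∈ T.image φ ↔
      T.symbol (B : Module.End k A) = 0 := by
    intro B
    rw [mem_image, T.symbol_eq_zero_iff]
    constructor
    · rintro ⟨w, hw⟩
      rw [octRep_apply, ← slRep_apply, ← sub_eq_zero, ← map_sub, slRep_eq_zero_iff] at hw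
      obtain ⟨c, hc⟩ := hw
      -- The lift to `sl(A)` is only known up to a scalar, which is multiplication by a constant of
      -- `A`.
      refine ⟨w - ⟨c • 1, 0⟩, ?_⟩
      have hc' : derRep k A ⟨c • 1, 0⟩ = c • 1 := by ext; simp [derRep_apply]
      rw [map_sub, hc', ← hc]
      exact sub_sub_self _ _
    · rintro ⟨w, hw⟩
      exact ⟨w, congrArg (slRep φ) (Subtype.ext hw : T.derRepSl w = B)⟩
  have hsurj : ∀ D, ∃ B, φ ((slEndScalars k A).quotientMap B) = D := fun D => by
    obtain ⟨B, hB⟩ := exists_slRep_eq φ D.2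
    exact ⟨B, Subtype.ext hB⟩
  constructor
  · intro h
    -- The operator `∂x ∂y` is traceless with symbol 1, so the image is proper.
    have h1 : T.opTwo 1 ∈ slEnd k A := by
      rw [T.mem_slEnd_iff, T.symbol_opTwo, T.one_eq, T.coords_symm_comb]; rfl
    have h2 := (hmem ⟨T.opTwo 1, h1⟩).1 (h ▸ LieSubalgebra.mem_top _)
    rw [T.symbol_opTwo] at h2
    exact one_ne_zero (α := k) (by simpa using congrArg T.aug h2)
  · intro N hN
    obtain ⟨D, hDN, hD⟩ := SetLike.exists_of_lt hN
    obtain ⟨u, rfl⟩ := hsurj D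
    have := T.eq_top_of_symbol_ne_zero (N.comap
      ((φ : pslEnd k A →ₗ⁅k⁆ lieAlg (groupG2 k)).comp (slEndScalars k A).quotientMap))
      (fun B hB => hN.le ((hmem B).2 hB)) (u := u) hDN (fun h => hD ((hmem u).2 h))
    rw [eq_top_iff]
    intro E _
    obtain ⟨B, rfl⟩ := hsurj E
    exact (this ▸ LieSubalgebra.mem_top B : B ∈ N.comap _)

/-- The abelian ideal of the image which comes from the multiplication operators. -/
noncomputable def mulIdeal : LieIdeal k (T.image φ) where
  carrier := {D | ∃ f, T.octRep φ ⟨f, 0⟩ = (D : Module.End k (SplitOct k))}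
  zero_mem' := ⟨0, (T.octRep φ).map_zero⟩
  add_mem' := by
    rintro _ _ ⟨f, hf⟩ ⟨g, hg⟩
    refine ⟨f + g, ?_⟩
    have : (⟨f + g, 0⟩ : DerSemidirect k A) = ⟨f, 0⟩ + ⟨g, 0⟩ := by ext <;> simp
    rw [this, map_add, hf, hg]; rfl
  smul_mem' := by
    rintro c _ ⟨f, hf⟩
    refine ⟨c • f, ?_⟩
    have : (⟨c • f, 0⟩ : DerSemidirect k A) = c • ⟨f, 0⟩ := by ext <;> simp
    rw [this, map_smul, hf]; rfl
  lie_mem := by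
    rintro E D ⟨f, hf⟩
    obtain ⟨w, hw⟩ := (T.mem_image φ).1 E.2
    refine ⟨⁅w, (⟨f, 0⟩ : DerSemidirect k A)⁆.left, ?_⟩
    have : (⟨⁅w, (⟨f, 0⟩ : DerSemidirect k A)⁆.left, 0⟩ : DerSemidirect k A) = ⁅w, ⟨f, 0⟩⁆ := by
      ext <;> simp
    rw [this, LieHom.map_lie, hf, hw]; rfl

theorem radical_image_ne_bot : LieAlgebra.radical k (T.image φ) ≠ ⊥ := by
  have hab : IsLieAbelian (T.mulIdeal φ) := by
    constructor
    rintro ⟨D, f, hf⟩ ⟨E, g, hg⟩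
    apply Subtype.ext; apply Subtype.ext; apply Subtype.ext
    change ⁅((D : lieAlg (groupG2 k)) : Module.End k (SplitOct k)), ((E : lieAlg (groupG2 k)) : Module.End k (SplitOct k))⁆ = 0
    have : ⁅(⟨f, 0⟩ : DerSemidirect k A), (⟨g, 0⟩ : DerSemidirect k A)⁆ = 0 := by
      ext <;> simp [Ring.lie_def, mul_comm]
    rw [← hf, ← hg, ← LieHom.map_lie, this, map_zero]
  have hle : T.mulIdeal φ ≤ LieAlgebra.radical k (T.image φ) := by
    rw [← LieAlgebra.LieIdeal.solvable_iff_le_radical]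
    infer_instance
  intro h
  rw [h, le_bot_iff] at hle
  have hx : (⟨φ ((slEndScalars k A).quotientMap (T.derRepSl ⟨T.x, 0⟩)),
      (T.mem_image φ).2 ⟨⟨T.x, 0⟩, rfl⟩⟩ : T.image φ) ∈ T.mulIdeal φ := ⟨T.x, rfl⟩
  rw [hle, LieSubmodule.mem_bot] at hx
  exact T.x_notMem ((T.octRep_eq_zero_iff φ).1
    (congrArg (fun D : T.image φ => ((D : lieAlg (groupG2 k)) : Module.End k (SplitOct k))) hx))

/-- This covers every subgroup of the automorphism group; a parabolic one enters only through its
inclusion in that group. -/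
theorem lieAlg_ne_image [IsAlgClosed k] {P : Subgroup (SplitOct k ≃ₗ[k] SplitOct k)}
    (hP : P ≤ groupG2 k) : lieAlg P ≠ (T.image φ).map (lieAlg (groupG2 k)).incl := by
  intro h
  have : Infinite k := inferInstance
  refine (T.isOctonionRep φ).not_lieAlg T hP fun D => ?_
  rw [h]
  constructor
  · rintro ⟨E, hE, rfl⟩
    exact (T.mem_image φ).1 hE
  · rintro ⟨w, rfl⟩
    exact ⟨φ ((slEndScalars k A).quotientMap (T.derRepSl w)), (T.mem_image φ).2 ⟨w, rfl⟩, rfl⟩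

end TruncData

theorem mainTheorem6 (k : Type*) [Field k] [IsAlgClosed k] [CharP k 2] :
    Nonempty (LinAlgGroup.lieAlg (groupG2 k) ≃ₗ⁅k⁆ psl 4 k) ∧
    Nonempty (pslEnd k (TruncPoly k) ≃ₗ⁅k⁆ LinAlgGroup.lieAlg (groupG2 k)) ∧
    Module.finrank k (WQuot k) = 11 ∧
    ∃ j : WQuot k →ₗ⁅k⁆ pslEnd k (TruncPoly k),
      (∀ w : WHat k, ∃ h : derRep k (TruncPoly k) w ∈ slEnd k (TruncPoly k),
        j (LieSubmodule.Quotient.mk w) = LieSubmodule.Quotient.mk ⟨derRep k (TruncPoly k) w, h⟩) ∧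
      Function.Injective j ∧
      ∀ φ : pslEnd k (TruncPoly k) ≃ₗ⁅k⁆ LinAlgGroup.lieAlg (groupG2 k),
        ∀ M : LieSubalgebra k (LinAlgGroup.lieAlg (groupG2 k)),
          M = j.range.map (φ : pslEnd k (TruncPoly k) →ₗ⁅k⁆ LinAlgGroup.lieAlg (groupG2 k)) →
            IsCoatom M ∧
            LieAlgebra.radical k M ≠ ⊥ ∧
            ¬ ∃ P, LinAlgGroup.IsParabolic (groupG2 k) P ∧
              LinAlgGroup.lieAlg P = M.map (LinAlgGroup.lieAlg (groupG2 k)).incl := by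
  have : Infinite k := inferInstance
  let T := TruncPoly.truncData k
  refine ⟨nonempty_psl_equiv.map LieEquiv.symm, nonempty_pslEnd_equiv T.basis, T.finrank_quotient,
    T.quotRep, fun w => ⟨T.derRep_mem_slEnd w, rfl⟩, T.quotRep_injective, ?_⟩
  rintro φ M rfl
  refine ⟨T.isCoatom_image φ, T.radical_image_ne_bot φ, ?_⟩
  rintro ⟨P, hP, h⟩
  exact T.lieAlg_ne_image φ hP.le h
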